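/- Let $a,b,c>0$. The \emph{dihedral graph} with parameters $a,b,c$ is the metric graph with four vertices $v_0,v_1,v_2,v_3$ and four edges: an edge of length $a$ joining $v_0$ to $v_1$, two parallel edges of lengths $2b$ and $2c$ joining $v_1$ to $v_2$, and an edge of length $a$ joining $v_2$ to $v_3$. Consider on it the eigenvalue problem $-f''=\lambda f$ on every edge, with the Dirichlet condition $f(v_0)=0$ at $v_0$ and Neumann (Kirchhoff) conditions at $v_1,v_2,v_3$: $f$ is continuous at the vertex, and the sum of the derivatives of $f$ at the vertex, taken in the direction from the vertex into each of the incident edges, is zero. Number the eigenvalues in nondecreasing order, with multiplicity, as $\lambda_1\le\lambda_2\le\cdots$. Theorem. Let $n\ge 1$. Suppose that the $n$-th eigenvalue $\lambda_n$ of the dihedral graph is simple and that the corresponding eigenfunction does not vanish at the vertices $v_1,v_2,v_3$. Then the number $\phi_n$ of zeros of the eigenfunction on the graph (the zero at the Dirichlet vertex $v_0$ not being counted) is finite and equals $$\phi_n \;=\; n-\operatorname{mod}_2\!\left(\left\lfloor \frac{b+c}{a+b+c}\,n\right\rfloor+1\right),$$ where $\operatorname{mod}_2(m)\in\{0,1\}$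 is the remainder of $m$ modulo $2$. -/

import Mathlib

/-- A compact quantum graph: finitely many edges, the edge `e` being identified with the interval
`[0, length e]` whose endpoints `0` and `length e` are attached to the vertices `src e` and `tgt e`.
Loops and multiple edges are allowed. Vertices in `dirichlet` carry the Dirichlet condition, all
others the Neumann (Kirchhoff) condition. The operator is `-d²/dx²`. -/
structure QuantumGraph (V E : Type*) where
  src : E → V
  tgt : E → V
  length : E → ℝ
  length_pos : ∀ e, 0 < length e
  dirichlet : Set V

namespace QuantumGraph

variable {V E : Type*} [DecidableEq V] [Fintype E]

/-- The closed interval with which the edge `e` is identified. -/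
def edge (Γ : QuantumGraph V E) (e : E) : Set ℝ := Set.Icc 0 (Γ.length e)

/-- `f` is a (possibly zero) solution of the eigenvalue problem `-f'' = lam f` on `Γ`.

A function on the graph is a collection of functions on its edges; the function on the edge `e` is
represented by a function on `ℝ` that is zero outside `[0, length e]`, so that two solutions are
equal if and only if they agree on every edge. The family `g` is the derivative of `f`
(one-sided at the ends of the edges) and `F` gives the values of `f` at the vertices. -/
def IsSolution (Γ : QuantumGraph V E) (lam : ℝ) (f : E → ℝ → ℂ) : Prop :=
  (∀ e, ∀ x ∉ Γ.edge e, f e x = 0) ∧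
  ∃ (g : E → ℝ → ℂ) (F : V → ℂ),
    -- the differential equation on every edge
    (∀ e, ∀ x ∈ Γ.edge e, HasDerivWithinAt (f e) (g e x) (Γ.edge e) x) ∧
    (∀ e, ∀ x ∈ Γ.edge e, HasDerivWithinAt (g e) (-((lam : ℂ) * f e x)) (Γ.edge e) x) ∧
    -- continuity at the vertices
    (∀ e, f e 0 = F (Γ.src e)) ∧
    (∀ e, f e (Γ.length e) = F (Γ.tgt e)) ∧
    -- the Dirichlet condition
    (∀ v ∈ Γ.dirichlet, F v = 0) ∧
    -- current conservation, all derivatives being taken from the vertex into the edge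
    (∀ v ∉ Γ.dirichlet,
      (∑ e, ((if Γ.src e = v then g e 0 else 0) +
        (if Γ.tgt e = v then -g e (Γ.length e) else 0))) = 0)

/-- The space of solutions of the eigenvalue problem for the number `lam`. -/
def eigenspace (Γ : QuantumGraph V E) (lam : ℝ) : Submodule ℂ (E → ℝ → ℂ) where
  carrier := {f | Γ.IsSolution lam f}
  zero_mem' := by
    refine ⟨fun e x _ => rfl, 0, 0, ?_, ?_, ?_, ?_, ?_, ?_⟩
    · intro e x _
      exact hasDerivWithinAt_const x _ (0 : ℂ)
    · intro e x _
      have e1 : -((lam : ℂ) * (0 : E → ℝ → ℂ) e x) = 0 := by simp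
      rw [e1]
      exact hasDerivWithinAt_const x _ (0 : ℂ)
    · intro e
      rfl
    · intro e
      rfl
    · intro v _
      rfl
    · intro v _
      simp
  add_mem' := by
    rintro f₁ f₂ ⟨hs, g₁, F₁, h1, h2, h3, h4, h5, h6⟩ ⟨ks, g₂, F₂, k1, k2, k3, k4, k5, k6⟩
    refine ⟨fun e x hx => ?_, g₁ + g₂, F₁ + F₂, ?_, ?_, ?_, ?_, ?_, ?_⟩
    · simp [hs e x hx, ks e x hx]
    · intro e x hx
      exact (h1 e x hx).add (k1 e x hx)
    · intro e x hx
      have h := (h2 e x hx).add (k2 e x hx)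
      have e1 : -((lam : ℂ) * f₁ e x) + -((lam : ℂ) * f₂ e x)
          = -((lam : ℂ) * (f₁ + f₂) e x) := by
        simp only [Pi.add_apply]
        ring
      rw [e1] at h
      exact h
    · intro e
      simp [h3 e, k3 e]
    · intro e
      simp [h4 e, k4 e]
    · intro v hv
      simp [h5 v hv, k5 v hv]
    · intro v hv
      refine Eq.trans ?_ ((congrArg₂ (fun z w : ℂ => z + w) (h6 v hv) (k6 v hv)).trans (add_zero 0))
      rw [← Finset.sum_add_distrib]
      refine Finset.sum_congr rfl fun e _ => ?_
      simp only [Pi.add_apply]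
      split_ifs <;> ring
  smul_mem' := by
    rintro c f ⟨hs, g, F, h1, h2, h3, h4, h5, h6⟩
    refine ⟨fun e x hx => ?_, c • g, c • F, ?_, ?_, ?_, ?_, ?_, ?_⟩
    · simp [hs e x hx]
    · intro e x hx
      exact (h1 e x hx).const_smul c
    · intro e x hx
      have h := (h2 e x hx).const_smul c
      have e1 : c • (-((lam : ℂ) * f e x)) = -((lam : ℂ) * (c • f) e x) := by
        simp only [Pi.smul_apply, smul_eq_mul]
        ring
      rw [e1] at h
      exact h
    · intro e
      simp [h3 e]
    · intro e
      simp [h4 e]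
    · intro v hv
      simp [h5 v hv]
    · intro v hv
      refine Eq.trans ?_ ((congrArg (fun z : ℂ => c * z) (h6 v hv)).trans (mul_zero c))
      simp only [Finset.mul_sum]
      refine Finset.sum_congr rfl fun e _ => ?_
      simp only [Pi.smul_apply, smul_eq_mul]
      split_ifs <;> ring

/-- The multiplicity of `lam`: the dimension of its eigenspace (`0` if `lam` is no eigenvalue). -/
noncomputable def multiplicity (Γ : QuantumGraph V E) (lam : ℝ) : ℕ∞ :=
  Cardinal.toENat (Module.rank ℂ (Γ.eigenspace lam))

/-- `lam` is a simple eigenvalue. -/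
def IsSimpleEigenvalue (Γ : QuantumGraph V E) (lam : ℝ) : Prop :=
  Γ.multiplicity lam = 1

/-- The number of eigenvalues in the set `S`, counted with multiplicity: an eigenvalue `μ` of
multiplicity `m` contributes the `m` pairs `(μ, 0), …, (μ, m - 1)`. -/
noncomputable def eigenvalueCount (Γ : QuantumGraph V E) (S : Set ℝ) : ℕ∞ :=
  {p : ℝ × ℕ | p.1 ∈ S ∧ (p.2 : ℕ∞) < Γ.multiplicity p.1}.encard

/-- `lam` is the `n`-th eigenvalue (`n = 1, 2, …`) when the eigenvalues are listed in nondecreasing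
order, each repeated according to its multiplicity. -/
def IsNthEigenvalue (Γ : QuantumGraph V E) (n : ℕ) (lam : ℝ) : Prop :=
  Γ.eigenvalueCount (Set.Iio lam) < n ∧ (n : ℕ∞) ≤ Γ.eigenvalueCount (Set.Iic lam)

/-- `f` is an eigenfunction for the eigenvalue `lam`. -/
def IsEigenfunction (Γ : QuantumGraph V E) (lam : ℝ) (f : E → ℝ → ℂ) : Prop :=
  f ∈ Γ.eigenspace lam ∧ f ≠ 0

/-- `f` does not vanish at any vertex other than the Dirichlet vertices. -/
def NonvanishingAtVertices (Γ : QuantumGraph V E) (f : E → ℝ → ℂ) : Prop :=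
  (∀ e, Γ.src e ∉ Γ.dirichlet → f e 0 ≠ 0) ∧
  (∀ e, Γ.tgt e ∉ Γ.dirichlet → f e (Γ.length e) ≠ 0)

/-- The zeros of `f` in the interiors of the edges. For a function that does not vanish at the
non-Dirichlet vertices these are all its zeros apart from those at the Dirichlet vertices. -/
def zeros (Γ : QuantumGraph V E) (f : E → ℝ → ℂ) : Set (E × ℝ) :=
  {p | p.2 ∈ Set.Ioo 0 (Γ.length p.1) ∧ f p.1 p.2 = 0}

end QuantumGraph

/-- The dihedral graph with parameters `a`, `b`, `c`. The vertices `1` and `2` are joined by two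
parallel edges of lengths `2b` and `2c`, which form the cycle; an edge of length `a` joins the
vertex `1` to the end vertex `0`, and another edge of length `a` joins the vertex `2` to the end
vertex `3`. The condition is Dirichlet at the vertex `0` and Neumann at all others. -/
def dihedralGraph (a b c : ℝ) (ha : 0 < a) (hb : 0 < b) (hc : 0 < c) :
    QuantumGraph (Fin 4) (Fin 4) where
  src := ![0, 1, 1, 2]
  tgt := ![1, 2, 2, 3]
  length := ![a, 2 * b, 2 * c, a]
  length_pos := by
    intro e
    fin_cases e
    · exact ha
    · exact mul_pos two_pos hb
    · exact mul_pos two_pos hc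
    · exact ha
  dirichlet := {0}

/-! An energy argument leaves only positive eigenvalues `k ^ 2`, so eigenfunctions are trigonometric
on each edge. Call `k` a cycle frequency if the cycle carries an eigenfunction vanishing at both of
its vertices. At every other `k`, continuity reduces the problem to a real system of two equations
in a symmetric and an antisymmetric amplitude on the cycle. Its determinant `secular` is a negative
multiple of `sin (phase a b c k)`, where `phase = 2ka + 2k(b + c) + ω` with `|ω| < π / 2`.

The phase increases strictly between cycle frequencies and jumps up by `π` at each of them. Once the
jumps are filled in, every level `πj`, `j ≥ 1`, is met at exactly one `k > 0`, and the multiplicity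
of `k ^ 2` is the number of levels met there (`multiplicity_eq_encard_levels`). A simple eigenvalue
whose eigenfunction does not vanish at the vertices is not at a cycle frequency, so for `λ_n = k ^
2` the phase is exactly `πn` (`phase_eq_of_isNthEigenvalue`).

Put `ζ = 2ka/π`, `μ = 2k(b + c)/π`, `η = ω/π`, so that `n = ζ + μ + η`. The signs of `sin π(μ + η)`
and `sin πμ` agree and `|η| < 1`, whence `⌊μ + η⌋ = ⌊μ⌋`. This gives `⌊ζ⌋ = n - 1 - ⌊μ⌋`, and `⌊μ⌋`
is also the floor appearing in the theorem (`floor_phase_terms`).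

The two leads carry `⌊ζ⌋` zeros together. The number `Z` of zeros on the cycle is even, because `f`
changes sign an even number of times around a loop, and the Kirchhoff conditions confine `Z` to
`⌊μ⌋` or `⌊μ⌋ + 1` (`ncard_zeros_ofCoeff`). The total is thus `n - 1` for even `⌊μ⌋` and `n` for odd
`⌊μ⌋`. -/

open Real Filter Topology

/-! ### The phase function -/

/-- The product `sin 2X sin 2Y / 4` with `X = k b`, `Y = k c`. -/
noncomputable def phaseQ (b c k : ℝ) : ℝ := sin (2 * (k * b)) * sin (2 * (k * c)) / 4

/-- With `S`, `C` the sine and cosine of `k(b + c)` and `q = phaseQ b c k`, `phaseRe + i phaseIm` is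
`-(q + S²) + iSC` rotated by the angle `-2k(b + c)`. The rotation brings it into the right
half-plane, where its argument is an arctangent. -/
noncomputable def phaseRe (b c k : ℝ) : ℝ :=
  sin (k * (b + c)) ^ 2 * (1 + 2 * phaseQ b c k) - phaseQ b c k

noncomputable def phaseIm (b c k : ℝ) : ℝ :=
  sin (k * (b + c)) * cos (k * (b + c)) * (1 + 2 * phaseQ b c k)

/-- The phase whose multiples of `π` are the eigenfrequencies of the dihedral graph. -/
noncomputable def phase (a b c k : ℝ) : ℝ :=
  2 * (k * a) + 2 * (k * (b + c)) + arctan (phaseIm b c k / phaseRe b c k)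

/-- The frequencies at which the cycle supports eigenfunctions vanishing at `v₁` and `v₂`. -/
def IsCycleFrequency (b c k : ℝ) : Prop := sin (k * (b + c)) = 0 ∧ sin (2 * (k * b)) = 0

open Classical in
-- `phaseLower` and `phaseUpper` are the ends of the vertical segment filling in the jump of the
-- phase; they coincide away from the jumps.
noncomputable def phaseLower (a b c k : ℝ) : ℝ :=
  if IsCycleFrequency b c k then phase a b c k - π / 2 else phase a b c k

open Classical in
noncomputable def phaseUpper (a b c k : ℝ) : ℝ :=
  if IsCycleFrequency b c k then phase a b c k + π / 2 else phase a b c k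

section Phase

variable {a b c k : ℝ}

/-- The difference of the two sides is `sin² (k(b - c))`. -/
theorem phaseQ_le (b c k : ℝ) : 4 * phaseQ b c k ≤ sin (k * (b + c)) ^ 2 := by
  unfold phaseQ
  rw [mul_add, sin_add, sin_two_mul, sin_two_mul]
  nlinarith [sq_nonneg (sin (k * b) * cos (k * c) - cos (k * b) * sin (k * c))]

theorem neg_le_phaseQ (b c k : ℝ) : -1 ≤ 4 * phaseQ b c k := by
  unfold phaseQ
  have h := abs_mul (sin (2 * (k * b))) (sin (2 * (k * c)))
  have h1 : |sin (2 * (k * b))| * |sin (2 * (k * c))| ≤ 1 :=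
    mul_le_one₀ (abs_sin_le_one _) (abs_nonneg _) (abs_sin_le_one _)
  have h2 := neg_abs_le (sin (2 * (k * b)) * sin (2 * (k * c)))
  linarith

theorem phaseRe_nonneg (b c k : ℝ) : 0 ≤ phaseRe b c k := by
  unfold phaseRe
  have h1 := phaseQ_le b c k
  have h2 := neg_le_phaseQ b c k
  rcases le_total (phaseQ b c k) 0 with h | h
  · nlinarith [mul_nonneg (sq_nonneg (sin (k * (b + c)))) (by linarith : 0 ≤ 1 + 2 * phaseQ b c k)]
  · nlinarith [mul_nonneg (sq_nonneg (sin (k * (b + c)))) h]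

theorem phaseRe_eq_zero_iff : phaseRe b c k = 0 ↔ IsCycleFrequency b c k := by
  have h1 := phaseQ_le b c k
  have h2 := neg_le_phaseQ b c k
  constructor
  · intro h
    have key : sin (k * (b + c)) = 0 ∧ phaseQ b c k = 0 := by
      unfold phaseRe at h
      rcases le_total (phaseQ b c k) 0 with h0 | h0
      · have h3 := mul_nonneg (sq_nonneg (sin (k * (b + c))))
          (by linarith : 0 ≤ 1 / 2 + 2 * phaseQ b c k)
        have h4 := sq_nonneg (sin (k * (b + c)))
        have h5 : sin (k * (b + c)) ^ 2 = 0 := by linarith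
        exact ⟨by simpa using h5, by rw [h5] at h; linarith⟩
      · have h3 := mul_nonneg (sq_nonneg (sin (k * (b + c)))) h0
        have h4 : phaseQ b c k = 0 := by linarith
        rw [h4] at h
        exact ⟨by simpa using h, h4⟩
    refine ⟨key.1, ?_⟩
    -- With `sin (k(b + c)) = 0` the angles `2kb` and `2kc` add up to a multiple of `2π`, so
    -- `phaseQ` is `-sin² (2kb) / 4`.
    have h3 : sin (2 * (k * c)) = - sin (2 * (k * b)) := by
      have : 2 * (k * c) = 2 * (k * (b + c)) - 2 * (k * b) := by ring
      rw [this, sin_sub, sin_two_mul (k * (b + c)), cos_two_mul' (k * (b + c)), key.1]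
      have := sin_sq_add_cos_sq (k * (b + c))
      rw [key.1] at this
      linear_combination (-sin (2 * (k * b))) * this
    have h4 := key.2
    unfold phaseQ at h4
    rw [h3] at h4
    have : sin (2 * (k * b)) ^ 2 = 0 := by linarith
    simpa using this
  · rintro ⟨h3, h4⟩
    simp [phaseRe, phaseQ, h3, h4]

theorem phaseRe_pos (h : ¬ IsCycleFrequency b c k) : 0 < phaseRe b c k :=
  lt_of_le_of_ne (phaseRe_nonneg b c k) fun h0 => h (phaseRe_eq_zero_iff.1 h0.symm)

/-- Here `phaseRe` is zero and the quotient takes the default value `0`, which places the phase at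
the midpoint of its jump. -/
theorem phase_of_isCycleFrequency (h : IsCycleFrequency b c k) :
    phase a b c k = 2 * (k * a) + 2 * (k * (b + c)) := by
  simp [phase, phaseRe_eq_zero_iff.2 h]

theorem exists_polar {x y : ℝ} (hx : 0 < x) :
    ∃ ρ : ℝ, 0 < ρ ∧ ρ * cos (arctan (y / x)) = x ∧ ρ * sin (arctan (y / x)) = y := by
  have h : 0 < √(1 + (y / x) ^ 2) := by positivity
  refine ⟨x * √(1 + (y / x) ^ 2), by positivity, ?_, ?_⟩
  · rw [cos_arctan]; field_simp
  · rw [sin_arctan]; field_simp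

/-- The secular function. -/
noncomputable def secular (a b c k : ℝ) : ℝ :=
  sin (2 * (k * a)) * (phaseQ b c k + sin (k * (b + c)) ^ 2)
    - cos (2 * (k * a)) * (sin (k * (b + c)) * cos (k * (b + c)))

/-- Rotating `phaseRe + i phaseIm = ρ e^{iω}` back by `2k(b + c)` gives `-(q + S²) + iSC`; a further
rotation by `2ka` has imaginary part `-secular`. -/
theorem exists_mul_sin_phase (h : ¬ IsCycleFrequency b c k) : ∃ ρ : ℝ, 0 < ρ ∧
    ρ * sin (2 * (k * (b + c)) + arctan (phaseIm b c k / phaseRe b c k))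
      = sin (k * (b + c)) * cos (k * (b + c)) ∧
    ∀ a, ρ * sin (phase a b c k) = - secular a b c k := by
  obtain ⟨ρ, hρ, h1, h2⟩ := exists_polar (y := phaseIm b c k) (phaseRe_pos h)
  set ω := arctan (phaseIm b c k / phaseRe b c k) with hω
  have hsc := sin_sq_add_cos_sq (k * (b + c))
  have e1 : ρ * sin (2 * (k * (b + c)) + ω) = sin (k * (b + c)) * cos (k * (b + c)) := by
    rw [sin_add, sin_two_mul, cos_two_mul']
    unfold phaseIm at h2
    unfold phaseRe at h1
    linear_combination (2 * sin (k * (b + c)) * cos (k * (b + c))) * h1 +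
      (cos (k * (b + c)) ^ 2 - sin (k * (b + c)) ^ 2) * h2
      + (sin (k * (b + c)) * cos (k * (b + c)) * (1 + 2 * phaseQ b c k)) * hsc
  have e2 : ρ * cos (2 * (k * (b + c)) + ω) = -(phaseQ b c k + sin (k * (b + c)) ^ 2) := by
    rw [cos_add, sin_two_mul, cos_two_mul']
    unfold phaseIm at h2
    unfold phaseRe at h1
    linear_combination (cos (k * (b + c)) ^ 2 - sin (k * (b + c)) ^ 2) * h1 -
      (2 * sin (k * (b + c)) * cos (k * (b + c))) * h2
      - (sin (k * (b + c)) ^ 2 * (1 + 2 * phaseQ b c k) + phaseQ b c k) * hsc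
  refine ⟨ρ, hρ, e1, fun a => ?_⟩
  have : phase a b c k = 2 * (k * a) + (2 * (k * (b + c)) + ω) := by
    rw [hω, phase]; ring
  rw [this, sin_add, secular]
  linear_combination sin (2 * (k * a)) * e2 + cos (2 * (k * a)) * e1

theorem sin_phase_eq_zero_iff (h : ¬ IsCycleFrequency b c k) :
    sin (phase a b c k) = 0 ↔ secular a b c k = 0 := by
  obtain ⟨ρ, hρ, -, h2⟩ := exists_mul_sin_phase h
  have := h2 a
  constructor
  · intro h0
    rw [h0] at this
    linarith
  · intro h0
    rw [h0] at this
    simpa [hρ.ne'] using this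

/-- With `R`, `I` for `phaseRe`, `phaseIm`, the derivative is `2a` plus a sum of nonnegative squares
divided by `R² + I²`, hence positive. -/
theorem exists_hasDerivAt_phase (ha : 0 < a) (hb : 0 < b) (hc : 0 < c)
    (h : ¬ IsCycleFrequency b c k) : ∃ d, 0 < d ∧ HasDerivAt (phase a b c) d k := by
  have hR := phaseRe_pos h
  have hlin : ∀ t : ℝ, HasDerivAt (fun k : ℝ => k * t) t k := fun t => by
    simpa using (hasDerivAt_id k).mul_const t
  have hlin2 : ∀ t : ℝ, HasDerivAt (fun k : ℝ => 2 * (k * t)) (2 * t) k := fun t =>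
    (hlin t).const_mul 2
  set S := sin (k * (b + c)) with hS
  set C := cos (k * (b + c)) with hC
  set q := phaseQ b c k with hq
  set q' := (cos (2 * (k * b)) * (2 * b) * sin (2 * (k * c)) +
    sin (2 * (k * b)) * (cos (2 * (k * c)) * (2 * c))) / 4 with hq'
  have dS : HasDerivAt (fun k : ℝ => sin (k * (b + c))) (C * (b + c)) k := (hlin (b + c)).sin
  have dC : HasDerivAt (fun k : ℝ => cos (k * (b + c))) (-S * (b + c)) k := (hlin (b + c)).cos
  have dq : HasDerivAt (phaseQ b c) q' k := ((hlin2 b).sin.mul (hlin2 c).sin).div_const 4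
  have dR : HasDerivAt (phaseRe b c)
      (2 * S * (C * (b + c)) * (1 + 2 * q) + S ^ 2 * (2 * q') - q') k := by
    refine (((dS.pow 2).mul ((dq.const_mul 2).const_add 1)).sub dq).congr_deriv ?_
    simp [hS, hq]
  have dI : HasDerivAt (phaseIm b c)
      ((C * (b + c) * C + S * (-S * (b + c))) * (1 + 2 * q) + S * C * (2 * q')) k :=
    (dS.mul dC).mul ((dq.const_mul 2).const_add 1)
  have dψ := ((hlin2 a).add (hlin2 (b + c))).add (dI.div dR hR.ne').arctan
  refine ⟨_, ?_, dψ⟩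
  set R := phaseRe b c k with hRd
  set I := phaseIm b c k with hId
  have hR' : R = S ^ 2 * (1 + 2 * q) - q := rfl
  have hI' : I = S * C * (1 + 2 * q) := rfl
  have hsc : S ^ 2 + C ^ 2 = 1 := sin_sq_add_cos_sq _
  have hq4 : q = sin (2 * (k * b)) * sin (2 * (k * c)) / 4 := rfl
  have hs2 : 2 * S * C = sin (2 * (k * b)) * cos (2 * (k * c)) +
      cos (2 * (k * b)) * sin (2 * (k * c)) := by
    rw [hS, hC, ← sin_two_mul, ← sin_add]; ring_nf
  have hc2 : C ^ 2 - S ^ 2 = cos (2 * (k * b)) * cos (2 * (k * c)) -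
      sin (2 * (k * b)) * sin (2 * (k * c)) := by
    rw [hS, hC, ← cos_two_mul', ← cos_add]; ring_nf
  have hbsc := sin_sq_add_cos_sq (2 * (k * b))
  have hcsc := sin_sq_add_cos_sq (2 * (k * c))
  set sb := sin (2 * (k * b))
  set cb := cos (2 * (k * b))
  set sc := sin (2 * (k * c))
  set cc := cos (2 * (k * c))
  have hN : R ^ 2 + I ^ 2 = S ^ 2 * (1 + 2 * q) + q ^ 2 := by
    rw [hR', hI']
    linear_combination S ^ 2 * (1 + 2 * q) ^ 2 * hsc
  have hpos : 0 < R ^ 2 + I ^ 2 := by positivity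
  have hW : ((C * (b + c) * C + S * (-S * (b + c))) * (1 + 2 * q) + S * C * (2 * q')) * R
      - I * (2 * S * (C * (b + c)) * (1 + 2 * q) + S ^ 2 * (2 * q') - q')
      = -(b + c) * (1 + 2 * q) * (S ^ 2 + q) + q' * S * C := by
    rw [hR', hI']
    linear_combination ((b + c) * (1 + 2 * q) * (-S ^ 2 * (1 + 2 * q) - q)) * hsc
  -- The linear term `2(b + c)` outweighs the derivative of the arctangent: over the common
  -- denominator the numerator becomes a sum of squares, by the addition formulas for `2kb + 2kc`.
  have hfin : 2 * (b + c) * (R ^ 2 + I ^ 2) +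
      (-(b + c) * (1 + 2 * q) * (S ^ 2 + q) + q' * S * C)
      = (b + c) * S ^ 2 + b * sc ^ 2 / 4 + c * sb ^ 2 / 4 := by
    rw [hN]
    have h1 : 2 * (b + c) * (S ^ 2 * (1 + 2 * q) + q ^ 2) +
      (-(b + c) * (1 + 2 * q) * (S ^ 2 + q) + q' * S * C) =
      (b + c) * S ^ 2 - (b + c) * q * (C ^ 2 - S ^ 2) + q' * (2 * S * C) / 2 := by
      linear_combination (b + c) * q * hsc
    rw [h1, hs2, hc2, hq4, hq']
    linear_combination (b * sc ^ 2 / 4) * hbsc + (c * sb ^ 2 / 4) * hcsc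
  have h2 : 1 / (1 + (I / R) ^ 2) * ((((C * (b + c) * C + S * (-S * (b + c))) * (1 + 2 * q)
      + S * C * (2 * q')) * R
      - I * (2 * S * (C * (b + c)) * (1 + 2 * q) + S ^ 2 * (2 * q') - q')) / R ^ 2)
      = (-(b + c) * (1 + 2 * q) * (S ^ 2 + q) + q' * S * C) / (R ^ 2 + I ^ 2) := by
    rw [hW]; field_simp
  show 0 < 2 * a + 2 * (b + c) + 1 / (1 + (I / R) ^ 2) * ((((C * (b + c) * C + S * (-S * (b + c))) * (1 + 2 * q)
      + S * C * (2 * q')) * R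
      - I * (2 * S * (C * (b + c)) * (1 + 2 * q) + S ^ 2 * (2 * q') - q')) / R ^ 2)
  rw [h2]
  have h3 : 2 * a + 2 * (b + c) + (-(b + c) * (1 + 2 * q) * (S ^ 2 + q) + q' * S * C)
      / (R ^ 2 + I ^ 2) = 2 * a + ((b + c) * S ^ 2 + b * sc ^ 2 / 4 + c * sb ^ 2 / 4)
      / (R ^ 2 + I ^ 2) := by
    rw [← hfin]; field_simp; ring
  rw [h3]
  positivity

theorem continuous_phaseRe (b c : ℝ) : Continuous (phaseRe b c) := by
  unfold phaseRe phaseQ; fun_prop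

theorem eventually_not_isCycleFrequency (h : ¬ IsCycleFrequency b c k) :
    ∀ᶠ t in 𝓝 k, ¬ IsCycleFrequency b c t := by
  have := (continuous_phaseRe b c).continuousAt.eventually (lt_mem_nhds (phaseRe_pos h))
  filter_upwards [this] with t ht h0
  exact ht.ne' (phaseRe_eq_zero_iff.2 h0)

theorem phaseLower_le_phaseUpper (a b c k : ℝ) : phaseLower a b c k ≤ phaseUpper a b c k := by
  unfold phaseLower phaseUpper
  split_ifs
  · linarith [pi_pos]
  · exact le_rfl

theorem le_phaseLower (a b c k : ℝ) :
    2 * (k * a) + 2 * (k * (b + c)) - π / 2 ≤ phaseLower a b c k := by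
  unfold phaseLower
  split_ifs with h
  · rw [phase_of_isCycleFrequency h]
  · rw [phase]
    linarith [neg_pi_div_two_lt_arctan (phaseIm b c k / phaseRe b c k)]

theorem phaseUpper_le (a b c k : ℝ) :
    phaseUpper a b c k ≤ 2 * (k * a) + 2 * (k * (b + c)) + π / 2 := by
  unfold phaseUpper
  split_ifs with h
  · rw [phase_of_isCycleFrequency h]
  · rw [phase]
    linarith [arctan_lt_pi_div_two (phaseIm b c k / phaseRe b c k)]

/-- At a cycle frequency `2kb` and `2kc` are multiples of `π` of equal parity, so the shift by `k`
changes both sines by the same sign. -/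
theorem IsCycleFrequency.phaseQ_add (h : IsCycleFrequency b c k) (δ : ℝ) :
    phaseQ b c (k + δ) = sin (2 * (δ * b)) * sin (2 * (δ * c)) / 4 := by
  obtain ⟨h1, h2⟩ := h
  have h3 : cos (2 * (k * (b + c))) = 1 := by
    have := sin_sq_add_cos_sq (k * (b + c))
    rw [cos_two_mul']
    rw [h1] at this ⊢
    linarith
  have h4 : sin (2 * (k * (b + c))) = 0 := by rw [sin_two_mul, h1]; ring
  have h5 : sin (2 * (k * c)) = 0 := by
    have : 2 * (k * c) = 2 * (k * (b + c)) - 2 * (k * b) := by ring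
    rw [this, sin_sub, h4, h2]; ring
  have h6 : cos (2 * (k * b)) * cos (2 * (k * c)) = 1 := by
    have : 2 * (k * (b + c)) = 2 * (k * b) + 2 * (k * c) := by ring
    rw [this, cos_add, h2] at h3
    linarith
  unfold phaseQ
  rw [show 2 * ((k + δ) * b) = 2 * (k * b) + 2 * (δ * b) by ring,
    show 2 * ((k + δ) * c) = 2 * (k * c) + 2 * (δ * c) by ring, sin_add, sin_add, h2, h5]
  linear_combination (sin (2 * (δ * b)) * sin (2 * (δ * c)) / 4) * h6

theorem IsCycleFrequency.phaseRe_add (h : IsCycleFrequency b c k) (δ : ℝ) :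
    phaseRe b c (k + δ) = sin (δ * (b + c)) ^ 2 * (1 + 2 * phaseQ b c (k + δ))
      - phaseQ b c (k + δ) := by
  have := sin_sq_add_cos_sq (k * (b + c))
  unfold phaseRe
  rw [add_mul, sin_add, h.1]
  rw [h.1] at this
  linear_combination (sin (δ * (b + c)) ^ 2 * (1 + 2 * phaseQ b c (k + δ))) * this

theorem IsCycleFrequency.phaseIm_add (h : IsCycleFrequency b c k) (δ : ℝ) :
    phaseIm b c (k + δ) = sin (δ * (b + c)) * cos (δ * (b + c)) *
      (1 + 2 * phaseQ b c (k + δ)) := by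
  have := sin_sq_add_cos_sq (k * (b + c))
  unfold phaseIm
  rw [add_mul, sin_add, cos_add, h.1]
  rw [h.1] at this
  linear_combination (sin (δ * (b + c)) * cos (δ * (b + c)) * (1 + 2 * phaseQ b c (k + δ))) * this

/-- Around a cycle frequency `phaseRe` is even and `phaseIm` odd in the displacement `δ`. Since `q >
0`, their quotient at `k + δ` is at least `cot (δ(b + c))`, so the arctangent tends to `±π / 2` on
the two sides, and the error is at most `δ(b + c)`. The linear part of the phase moves by more than
that. -/
theorem IsCycleFrequency.near (hb : 0 < b) (hc : 0 < c) (h : IsCycleFrequency b c k) {δ : ℝ}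
    (h0 : 0 < δ) (h1 : 2 * (δ * (b + c)) < π) :
    (¬ IsCycleFrequency b c (k + δ) ∧
      π / 2 - δ * (b + c) ≤ arctan (phaseIm b c (k + δ) / phaseRe b c (k + δ))) ∧
    (¬ IsCycleFrequency b c (k - δ) ∧
      arctan (phaseIm b c (k - δ) / phaseRe b c (k - δ)) ≤ -(π / 2 - δ * (b + c))) := by
  have hδb : 0 < δ * b := by positivity
  have hδc : 0 < δ * c := by positivity
  have hs : 0 < sin (δ * (b + c)) := sin_pos_of_pos_of_lt_pi (by positivity) (by nlinarith)
  have hcos : 0 < cos (δ * (b + c)) :=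
    cos_pos_of_mem_Ioo ⟨by linarith [pi_pos, mul_pos h0 (add_pos hb hc)], by linarith⟩
  have hq : 0 < sin (2 * (δ * b)) * sin (2 * (δ * c)) / 4 := by
    have := sin_pos_of_pos_of_lt_pi (by positivity : 0 < 2 * (δ * b)) (by nlinarith)
    have := sin_pos_of_pos_of_lt_pi (by positivity : 0 < 2 * (δ * c)) (by nlinarith)
    positivity
  set q := sin (2 * (δ * b)) * sin (2 * (δ * c)) / 4 with hqd
  have hqp := h.phaseQ_add δ
  have hqm : phaseQ b c (k - δ) = q := by
    rw [sub_eq_add_neg, h.phaseQ_add (-δ), hqd]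
    simp only [neg_mul, mul_neg, sin_neg]
    ring
  have hRp := h.phaseRe_add δ
  have hIp := h.phaseIm_add δ
  have hRm : phaseRe b c (k - δ) = sin (δ * (b + c)) ^ 2 * (1 + 2 * q) - q := by
    rw [sub_eq_add_neg, h.phaseRe_add (-δ), ← sub_eq_add_neg, hqm]
    simp
  have hIm : phaseIm b c (k - δ) = -(sin (δ * (b + c)) * cos (δ * (b + c)) * (1 + 2 * q)) := by
    rw [sub_eq_add_neg, h.phaseIm_add (-δ), ← sub_eq_add_neg, hqm]
    simp
  rw [hqp] at hRp hIp
  have hqle : 4 * q ≤ sin (δ * (b + c)) ^ 2 := by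
    have := phaseQ_le b c δ
    exact this
  have hR : 0 < sin (δ * (b + c)) ^ 2 * (1 + 2 * q) - q := by nlinarith
  have hbd : π / 2 - δ * (b + c) ≤ arctan (sin (δ * (b + c)) * cos (δ * (b + c)) * (1 + 2 * q) /
      (sin (δ * (b + c)) ^ 2 * (1 + 2 * q) - q)) := by
    have h2 : arctan (tan (π / 2 - δ * (b + c))) = π / 2 - δ * (b + c) :=
      arctan_tan (by linarith [pi_pos]) (by linarith [mul_pos h0 (add_pos hb hc)])
    rw [← h2]
    apply arctan_strictMono.monotone
    rw [tan_pi_div_two_sub, tan_eq_sin_div_cos, inv_div, div_le_div_iff₀ hs hR]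
    nlinarith [mul_pos hcos hq]
  refine ⟨⟨fun h3 => ?_, ?_⟩, fun h3 => ?_, ?_⟩
  · rw [phaseRe_eq_zero_iff.2 h3] at hRp
    exact hR.ne hRp
  · rw [hRp, hIp]; exact hbd
  · rw [phaseRe_eq_zero_iff.2 h3] at hRm
    exact hR.ne hRm
  · rw [hRm, hIm, neg_div, arctan_neg]
    linarith

/-! ### Monotonicity and intermediate values of the phase with its jumps filled in -/

theorem eventually_phaseUpper_lt_phaseLower_right (ha : 0 < a) (hb : 0 < b) (hc : 0 < c) (k : ℝ) :
    ∀ᶠ t in 𝓝[>] k, phaseUpper a b c k < phaseLower a b c t := by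
  by_cases h : IsCycleFrequency b c k
  · have hε : 0 < π / (2 * (b + c)) := by have := pi_pos; positivity
    filter_upwards [Ioo_mem_nhdsGT (show k < k + π / (2 * (b + c)) by linarith)] with t ht
    obtain ⟨δ, rfl⟩ : ∃ δ, t = k + δ := ⟨t - k, by ring⟩
    have h0 : 0 < δ := by linarith [ht.1]
    have h1 : 2 * (δ * (b + c)) < π := by
      have : δ < π / (2 * (b + c)) := by linarith [ht.2]
      rw [lt_div_iff₀ (by positivity)] at this
      linarith
    obtain ⟨⟨h2, h3⟩, -⟩ := h.near hb hc h0 h1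
    rw [phaseUpper, if_pos h, phaseLower, if_neg h2, phase_of_isCycleFrequency h, phase]
    nlinarith [mul_pos h0 ha, mul_pos h0 (add_pos hb hc)]
  · obtain ⟨d, hd, hder⟩ := exists_hasDerivAt_phase ha hb hc h
    have hsl := (hasDerivAt_iff_tendsto_slope.1 hder).eventually (lt_mem_nhds hd)
    have hsl' : ∀ᶠ t in 𝓝[>] k, 0 < slope (phase a b c) k t :=
      hsl.filter_mono (nhdsWithin_mono _ fun t ht => ne_of_gt ht)
    filter_upwards [hsl', (eventually_not_isCycleFrequency h).filter_mono nhdsWithin_le_nhds,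
      self_mem_nhdsWithin] with t h1 h2 h3
    rw [phaseUpper, if_neg h, phaseLower, if_neg h2]
    rw [slope_def_field, div_pos_iff_of_pos_right (sub_pos.2 h3)] at h1
    linarith

theorem eventually_phaseUpper_lt_phaseLower_left (ha : 0 < a) (hb : 0 < b) (hc : 0 < c) (k : ℝ) :
    ∀ᶠ t in 𝓝[<] k, phaseUpper a b c t < phaseLower a b c k := by
  by_cases h : IsCycleFrequency b c k
  · have hε : 0 < π / (2 * (b + c)) := by have := pi_pos; positivity
    filter_upwards [Ioo_mem_nhdsLT (show k - π / (2 * (b + c)) < k by linarith)] with t ht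
    obtain ⟨δ, rfl⟩ : ∃ δ, t = k - δ := ⟨k - t, by ring⟩
    have h0 : 0 < δ := by linarith [ht.2]
    have h1 : 2 * (δ * (b + c)) < π := by
      have : δ < π / (2 * (b + c)) := by linarith [ht.1]
      rw [lt_div_iff₀ (by positivity)] at this
      linarith
    obtain ⟨-, h2, h3⟩ := h.near hb hc h0 h1
    rw [phaseLower, if_pos h, phaseUpper, if_neg h2, phase_of_isCycleFrequency h, phase]
    nlinarith [mul_pos h0 ha, mul_pos h0 (add_pos hb hc)]
  · obtain ⟨d, hd, hder⟩ := exists_hasDerivAt_phase ha hb hc h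
    have hsl := (hasDerivAt_iff_tendsto_slope.1 hder).eventually (lt_mem_nhds hd)
    have hsl' : ∀ᶠ t in 𝓝[<] k, 0 < slope (phase a b c) k t :=
      hsl.filter_mono (nhdsWithin_mono _ fun t ht => ne_of_lt ht)
    filter_upwards [hsl', (eventually_not_isCycleFrequency h).filter_mono nhdsWithin_le_nhds,
      self_mem_nhdsWithin] with t h1 h2 h3
    rw [phaseLower, if_neg h, phaseUpper, if_neg h2]
    rw [slope_comm, slope_def_field, div_pos_iff_of_pos_right (sub_pos.2 h3)] at h1
    linarith

/-- The phase is not continuous, so the local comparisons on both sides of each point are made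
global by looking at the infimum of the points violating the inequality. -/
theorem phaseUpper_lt_phaseLower (ha : 0 < a) (hb : 0 < b) (hc : 0 < c) {s t : ℝ} (hst : s < t) :
    phaseUpper a b c s < phaseLower a b c t := by
  by_contra hcon
  set B : Set ℝ := {x | s < x ∧ phaseLower a b c x ≤ phaseUpper a b c s} with hB
  have hne : B.Nonempty := ⟨t, hst, not_lt.1 hcon⟩
  have hbd : BddBelow B := ⟨s, fun x hx => hx.1.le⟩
  have hsx : s ≤ sInf B := le_csInf hne fun x hx => hx.1.le
  set x := sInf B with hx
  have hright : ∀ᶠ y in 𝓝[>] x, phaseUpper a b c x < phaseLower a b c y :=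
    eventually_phaseUpper_lt_phaseLower_right ha hb hc x
  obtain ⟨y, hy, hyx⟩ := (mem_nhdsGT_iff_exists_Ioo_subset).1 hright
  obtain ⟨z, hzB, hzy⟩ := exists_lt_of_csInf_lt hne (show sInf B < y from hy)
  have hxz : x ≤ z := csInf_le hbd hzB
  have hux : phaseUpper a b c s ≤ phaseUpper a b c x ∧ (s < x → phaseUpper a b c s < phaseLower a b c x) := by
    rcases hsx.eq_or_lt with h | h
    · exact ⟨by rw [← h], fun h' => absurd h h'.ne⟩
    · have hleft := eventually_phaseUpper_lt_phaseLower_left ha hb hc x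
      obtain ⟨w, hw1, hw2⟩ := (hleft.and (Ioo_mem_nhdsLT h)).exists
      have hwB : w ∉ B := fun hw => absurd (csInf_le hbd hw) (not_le.2 hw2.2)
      have : phaseUpper a b c s < phaseLower a b c w := by
        by_contra h'
        exact hwB ⟨hw2.1, not_lt.1 h'⟩
      have h3 : phaseUpper a b c s < phaseLower a b c x :=
        (this.trans_le (phaseLower_le_phaseUpper a b c w)).trans hw1
      exact ⟨(h3.trans_le (phaseLower_le_phaseUpper a b c x)).le, fun _ => h3⟩
  rcases hxz.eq_or_lt with h | h
  · rw [← h] at hzB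
    exact absurd (hux.2 hzB.1) (not_lt.2 hzB.2)
  · have : phaseUpper a b c x < phaseLower a b c z := hyx ⟨h, hzy⟩
    linarith [hzB.2, hux.1]

/-- An intermediate value theorem: the supremum of the points where `phaseLower` has not exceeded
`l` works. The bound `π / 2` is the upper end of the jump at `0`. -/
theorem exists_phase_level (ha : 0 < a) (hb : 0 < b) (hc : 0 < c) {l : ℝ} (hl : π / 2 < l) :
    ∃ k, 0 < k ∧ phaseLower a b c k ≤ l ∧ l ≤ phaseUpper a b c k := by
  have h0 : phaseUpper a b c 0 ≤ π / 2 := by simpa using phaseUpper_le a b c 0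
  set B : Set ℝ := {x | 0 ≤ x ∧ phaseLower a b c x ≤ l} with hB
  have hne : B.Nonempty :=
    ⟨0, le_rfl, ((phaseLower_le_phaseUpper a b c 0).trans h0).trans hl.le⟩
  have hbd : BddAbove B := by
    -- The bound comes from `phaseLower a b c x ≥ 2xa - π / 2` for `x ≥ 0`.
    refine ⟨(l + π / 2) / (2 * a), fun x hx => ?_⟩
    have := (le_phaseLower a b c x).trans hx.2
    rw [le_div_iff₀ (by positivity)]
    nlinarith [mul_nonneg hx.1 (add_pos hb hc).le]
  set x := sSup B with hx
  have hx0 : 0 ≤ x := le_csSup hbd ⟨le_rfl, ((phaseLower_le_phaseUpper a b c 0).trans h0).trans hl.le⟩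
  have hcont : Continuous fun t : ℝ => 2 * (t * a) + 2 * (t * (b + c)) := by fun_prop
  have hU : l ≤ phaseUpper a b c x := by
    by_contra hlt
    push Not at hlt
    have : ∀ᶠ t in 𝓝[>] x, phaseLower a b c t < l := by
      by_cases h : IsCycleFrequency b c x
      · rw [phaseUpper, if_pos h, phase_of_isCycleFrequency h] at hlt
        have := ((hcont.add continuous_const).tendsto x).eventually (gt_mem_nhds hlt)
        filter_upwards [this.filter_mono nhdsWithin_le_nhds] with t ht
        exact ((phaseLower_le_phaseUpper a b c t).trans (phaseUpper_le a b c t)).trans_lt ht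
      · rw [phaseUpper, if_neg h] at hlt
        obtain ⟨d, -, hder⟩ := exists_hasDerivAt_phase ha hb hc h
        filter_upwards [(hder.continuousAt.eventually (gt_mem_nhds hlt)).filter_mono
          nhdsWithin_le_nhds,
          (eventually_not_isCycleFrequency h).filter_mono nhdsWithin_le_nhds] with t h1 h2
        rwa [phaseLower, if_neg h2]
    obtain ⟨t, h1, h2⟩ := (this.and self_mem_nhdsWithin).exists
    exact absurd (le_csSup hbd (show t ∈ B from ⟨hx0.trans (le_of_lt h2), h1.le⟩)) (not_le.2 h2)
  have hxpos : 0 < x := by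
    rcases hx0.eq_or_lt with h | h
    · rw [← h] at hU
      linarith
    · exact h
  refine ⟨x, hxpos, ?_, hU⟩
  by_contra hlt
  push Not at hlt
  have hxB : x ∉ B := fun h => absurd h.2 (not_le.2 hlt)
  have : ∀ᶠ t in 𝓝[<] x, l < phaseLower a b c t := by
    by_cases h : IsCycleFrequency b c x
    · rw [phaseLower, if_pos h, phase_of_isCycleFrequency h] at hlt
      have := ((hcont.sub continuous_const).tendsto x).eventually (lt_mem_nhds hlt)
      filter_upwards [this.filter_mono nhdsWithin_le_nhds] with t ht
      exact ht.trans_le (le_phaseLower a b c t)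
    · rw [phaseLower, if_neg h] at hlt
      obtain ⟨d, -, hder⟩ := exists_hasDerivAt_phase ha hb hc h
      filter_upwards [(hder.continuousAt.eventually (lt_mem_nhds hlt)).filter_mono
        nhdsWithin_le_nhds,
        (eventually_not_isCycleFrequency h).filter_mono nhdsWithin_le_nhds] with t h1 h2
      rwa [phaseLower, if_neg h2]
  obtain ⟨y, hy, hyx⟩ := (mem_nhdsLT_iff_exists_Ioo_subset).1 this
  obtain ⟨z, hzB, hzy⟩ := exists_lt_of_lt_csSup hne (show y < sSup B from hy)
  have hzx : z < x := lt_of_le_of_ne (le_csSup hbd hzB) fun h => hxB (h ▸ hzB)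
  exact absurd hzB.2 (not_le.2 (hyx ⟨hzy, hzx⟩))

end Phase

/-! ### Trigonometric solutions on an edge -/

/-- The solution `P cos (k (x - x₀)) + Q sin (k (x - x₀))` of `-f'' = k² f`. -/
noncomputable def trig (k x₀ : ℝ) (P Q : ℂ) (x : ℝ) : ℂ :=
  P * (cos (k * (x - x₀)) : ℝ) + Q * (sin (k * (x - x₀)) : ℝ)

section Trig

variable {k x₀ l : ℝ} {P Q : ℂ}

theorem hasDerivAt_trig (k x₀ : ℝ) (P Q : ℂ) (x : ℝ) :
    HasDerivAt (trig k x₀ P Q) (k * trig k x₀ Q (-P) x) x := by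
  have h0 : HasDerivAt (fun x : ℝ => k * (x - x₀)) k x := by
    simpa using ((hasDerivAt_id x).sub_const x₀).const_mul k
  refine ((h0.cos.ofReal_comp.const_mul P).add (h0.sin.ofReal_comp.const_mul Q)).congr_deriv ?_
  simp only [trig]
  push_cast
  ring

theorem trig_zero (k x₀ : ℝ) (P Q : ℂ) :
    trig k x₀ P Q 0 = P * (cos (k * x₀) : ℝ) - Q * (sin (k * x₀) : ℝ) := by
  simp [trig, sub_eq_add_neg]

theorem trig_two_mul (k x₀ : ℝ) (P Q : ℂ) :
    trig k x₀ P Q (2 * x₀) = P * (cos (k * x₀) : ℝ) + Q * (sin (k * x₀) : ℝ) := by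
  rw [trig, show 2 * x₀ - x₀ = x₀ by ring]

theorem trig_center_zero (k x : ℝ) (P Q : ℂ) :
    trig k 0 P Q x = P * (cos (k * x) : ℝ) + Q * (sin (k * x) : ℝ) := by
  rw [trig, sub_zero]

theorem trig_self (k x₀ : ℝ) (P Q : ℂ) : trig k x₀ P Q x₀ = P := by
  simp [trig]

theorem trig_eq_zero (hk : 0 < k) (hl : 0 < l) (hx₀ : x₀ ∈ Set.Icc 0 l)
    (h : ∀ x ∈ Set.Icc 0 l, trig k x₀ P Q x = 0) : P = 0 ∧ Q = 0 := by
  refine ⟨by simpa [trig_self] using h x₀ hx₀, ?_⟩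
  have h1 : HasDerivWithinAt (trig k x₀ P Q) 0 (Set.Icc 0 l) x₀ :=
    (hasDerivWithinAt_const x₀ (Set.Icc 0 l) (0 : ℂ)).congr h (h x₀ hx₀)
  have h2 := (uniqueDiffOn_Icc hl x₀ hx₀).eq_deriv _
    (hasDerivAt_trig k x₀ P Q x₀).hasDerivWithinAt h1
  rw [trig_self] at h2
  simpa [hk.ne'] using h2

theorem exists_eq_trig (hk : 0 < k) (x₀ : ℝ) (hl : 0 < l) {f g : ℝ → ℂ}
    (hf : ∀ x ∈ Set.Icc 0 l, HasDerivWithinAt f (g x) (Set.Icc 0 l) x)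
    (hg : ∀ x ∈ Set.Icc 0 l,
      HasDerivWithinAt g (-(((k ^ 2 : ℝ) : ℂ) * f x)) (Set.Icc 0 l) x) :
    ∃ P Q : ℂ, ∀ x ∈ Set.Icc 0 l, f x = trig k x₀ P Q x ∧ g x = k * trig k x₀ Q (-P) x := by
  have hconst : ∀ u : ℝ → ℂ, (∀ x ∈ Set.Icc 0 l, HasDerivWithinAt u 0 (Set.Icc 0 l) x) →
      ∀ x ∈ Set.Icc 0 l, u x = u 0 := fun u hu x hx => by
    have := (convex_Icc 0 l).norm_image_sub_le_of_norm_hasDerivWithin_le (C := 0) hu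
      (fun x _ => by simp) (Set.left_mem_Icc.2 hl.le) hx
    rw [zero_mul] at this
    exact sub_eq_zero.1 (norm_le_zero_iff.1 this)
  have hc : ∀ x, HasDerivAt (fun x : ℝ => ((cos (k * (x - x₀)) : ℝ) : ℂ))
      (-k * (sin (k * (x - x₀)) : ℝ)) x := fun x => by
    have h0 : HasDerivAt (fun x : ℝ => k * (x - x₀)) k x := by
      simpa using ((hasDerivAt_id x).sub_const x₀).const_mul k
    refine h0.cos.ofReal_comp.congr_deriv ?_
    push_cast
    ring
  have hs : ∀ x, HasDerivAt (fun x : ℝ => ((sin (k * (x - x₀)) : ℝ) : ℂ))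
      (k * (cos (k * (x - x₀)) : ℝ)) x := fun x => by
    have h0 : HasDerivAt (fun x : ℝ => k * (x - x₀)) k x := by
      simpa using ((hasDerivAt_id x).sub_const x₀).const_mul k
    refine h0.sin.ofReal_comp.congr_deriv ?_
    push_cast
    ring
  -- Variation of constants: these two combinations of `f` and `g` have derivative zero and are `k`
  -- times the coefficients.
  have hu := hconst (fun x => k * f x * (cos (k * (x - x₀)) : ℝ) - g x * (sin (k * (x - x₀)) : ℝ))
    fun x hx => by
      refine ((((hf x hx).const_mul (k : ℂ)).mul (hc x).hasDerivWithinAt).sub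
        ((hg x hx).mul (hs x).hasDerivWithinAt)).congr_deriv ?_
      push_cast
      ring
  have hv := hconst (fun x => k * f x * (sin (k * (x - x₀)) : ℝ) + g x * (cos (k * (x - x₀)) : ℝ))
    fun x hx => by
      refine ((((hf x hx).const_mul (k : ℂ)).mul (hs x).hasDerivWithinAt).add
        ((hg x hx).mul (hc x).hasDerivWithinAt)).congr_deriv ?_
      push_cast
      ring
  set u₀ := k * f 0 * (cos (k * (0 - x₀)) : ℝ) - g 0 * (sin (k * (0 - x₀)) : ℝ)
  set v₀ := k * f 0 * (sin (k * (0 - x₀)) : ℝ) + g 0 * (cos (k * (0 - x₀)) : ℝ)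
  have hk' : (k : ℂ) ≠ 0 := by exact_mod_cast hk.ne'
  refine ⟨u₀ / k, v₀ / k, fun x hx => ?_⟩
  have h1 := hu x hx
  have h2 := hv x hx
  have h3 : ((sin (k * (x - x₀)) : ℝ) : ℂ) ^ 2 + ((cos (k * (x - x₀)) : ℝ) : ℂ) ^ 2 = 1 := by
    exact_mod_cast sin_sq_add_cos_sq (k * (x - x₀))
  constructor
  · rw [trig]
    field_simp
    rw [← h1, ← h2]
    linear_combination (-(k : ℂ) * f x) * h3
  · rw [trig]
    field_simp
    rw [← h1, ← h2]
    linear_combination (-g x) * h3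

end Trig

/-! ### Reduction to linear algebra, and multiplicities -/

section Coefficients

variable {a b c k : ℝ}

/-- The equations satisfied by the coefficients `(A, B, p, q, r, s)` of an eigenfunction that is
`A sin (k x)` and `B cos (k (x - a))` on the edges of length `a`, and
`p cos (k (x - b)) + q sin (k (x - b))` and `r cos (k (x - c)) + s sin (k (x - c))` on those of the
cycle. -/
def IsCoeff (a b c k : ℝ) (v : Fin 6 → ℂ) : Prop :=
  v 0 * (sin (k * a) : ℝ) = v 2 * (cos (k * b) : ℝ) - v 3 * (sin (k * b) : ℝ) ∧
  v 0 * (sin (k * a) : ℝ) = v 4 * (cos (k * c) : ℝ) - v 5 * (sin (k * c) : ℝ) ∧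
  v 1 * (cos (k * a) : ℝ) = v 2 * (cos (k * b) : ℝ) + v 3 * (sin (k * b) : ℝ) ∧
  v 1 * (cos (k * a) : ℝ) = v 4 * (cos (k * c) : ℝ) + v 5 * (sin (k * c) : ℝ) ∧
  v 0 * (cos (k * a) : ℝ) = v 2 * (sin (k * b) : ℝ) + v 3 * (cos (k * b) : ℝ)
    + v 4 * (sin (k * c) : ℝ) + v 5 * (cos (k * c) : ℝ) ∧
  v 1 * (sin (k * a) : ℝ) = -v 2 * (sin (k * b) : ℝ) + v 3 * (cos (k * b) : ℝ)
    - v 4 * (sin (k * c) : ℝ) + v 5 * (cos (k * c) : ℝ)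

open Classical in
/-- The function on the dihedral graph with given coefficients. -/
noncomputable def ofCoeff (a b c k : ℝ) : (Fin 6 → ℂ) →ₗ[ℂ] (Fin 4 → ℝ → ℂ) where
  toFun v e x := if x ∈ Set.Icc 0 ((![a, 2 * b, 2 * c, a] : Fin 4 → ℝ) e) then
    trig k ((![0, b, c, a] : Fin 4 → ℝ) e) ((![0, v 2, v 4, v 1] : Fin 4 → ℂ) e)
      ((![v 0, v 3, v 5, 0] : Fin 4 → ℂ) e) x else 0
  map_add' v w := by
    ext e x
    simp only [Pi.add_apply]
    split_ifs
    · fin_cases e <;> simp [trig] <;> ring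
    · simp
  map_smul' t v := by
    ext e x
    simp only [Pi.smul_apply, RingHom.id_apply, smul_eq_mul]
    split_ifs
    · fin_cases e <;> simp [trig] <;> ring
    · simp

theorem ofCoeff_apply {v : Fin 6 → ℂ} {e : Fin 4} {x : ℝ}
    (hx : x ∈ Set.Icc 0 ((![a, 2 * b, 2 * c, a] : Fin 4 → ℝ) e)) :
    ofCoeff a b c k v e x = trig k ((![0, b, c, a] : Fin 4 → ℝ) e)
      ((![0, v 2, v 4, v 1] : Fin 4 → ℂ) e) ((![v 0, v 3, v 5, 0] : Fin 4 → ℂ) e) x :=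
  if_pos hx

theorem ofCoeff_injective (ha : 0 < a) (hb : 0 < b) (hc : 0 < c) (hk : 0 < k) :
    Function.Injective (ofCoeff a b c k) := by
  rw [← LinearMap.ker_eq_bot, LinearMap.ker_eq_bot']
  intro v hv
  have h : ∀ e, (![0, b, c, a] : Fin 4 → ℝ) e ∈ Set.Icc 0 ((![a, 2 * b, 2 * c, a] : Fin 4 → ℝ) e) →
      0 < (![a, 2 * b, 2 * c, a] : Fin 4 → ℝ) e → _ := fun e he hl =>
    trig_eq_zero (P := (![0, v 2, v 4, v 1] : Fin 4 → ℂ) e)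
      (Q := (![v 0, v 3, v 5, 0] : Fin 4 → ℂ) e) hk hl he fun x hx => by
        rw [← ofCoeff_apply hx, hv]; rfl
  have h0 := (h 0 ⟨le_rfl, ha.le⟩ ha).2
  have h1 := h 1 ⟨hb.le, by simp; linarith⟩ (by simpa using hb)
  have h2 := h 2 ⟨hc.le, by simp; linarith⟩ (by simpa using hc)
  have h3 := (h 3 ⟨ha.le, le_rfl⟩ ha).1
  ext i
  fin_cases i
  · exact h0
  · exact h3
  · exact h1.1
  · exact h1.2
  · exact h2.1
  · exact h2.2

theorem mem_eigenspace_iff (ha : 0 < a) (hb : 0 < b) (hc : 0 < c) (hk : 0 < k)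
    {f : Fin 4 → ℝ → ℂ} : f ∈ (dihedralGraph a b c ha hb hc).eigenspace (k ^ 2) ↔
      ∃ v, IsCoeff a b c k v ∧ ofCoeff a b c k v = f := by
  have hk' : (k : ℂ) ≠ 0 := by exact_mod_cast hk.ne'
  constructor
  · rintro ⟨hsupp, g, F, hf, hg, hF0, hF1, hD, hN⟩
    -- The centres are the midpoints of the cycle edges and the outer ends of the leads. The
    -- Dirichlet condition then kills the cosine on edge `0` and the Neumann condition the sine on
    -- edge `3`.
    have hex := fun e => exists_eq_trig hk ((![0, b, c, a] : Fin 4 → ℝ) e)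
      ((dihedralGraph a b c ha hb hc).length_pos e) (hf e) (hg e)
    choose P Q hPQ using hex
    have hlen := (dihedralGraph a b c ha hb hc).length_pos
    have L0 : ∀ e, _ := fun e => hPQ e 0 (Set.left_mem_Icc.2 (hlen e).le)
    have L1 : ∀ e, _ := fun e => hPQ e _ (Set.right_mem_Icc.2 (hlen e).le)
    have f00 := (L0 0).1
    have f10 := (L0 1).1
    have f20 := (L0 2).1
    have f30 := (L0 3).1
    have f01 := (L1 0).1
    have f11 := (L1 1).1
    have f21 := (L1 2).1
    have g10 := (L0 1).2
    have g20 := (L0 2).2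
    have g30 := (L0 3).2
    have g01 := (L1 0).2
    have g11 := (L1 1).2
    have g21 := (L1 2).2
    have g31 := (L1 3).2
    have F0 := hD 0 (by simp [dihedralGraph])
    have N1 := hN 1 (by simp [dihedralGraph])
    have N2 := hN 2 (by simp [dihedralGraph])
    have N3 := hN 3 (by simp [dihedralGraph])
    rw [hF0] at f00 f10 f20 f30
    rw [hF1] at f01 f11 f21
    simp [dihedralGraph, Fin.sum_univ_four, trig_zero, trig_two_mul, trig_self,
      trig_center_zero, F0] at f00 f10 f20 f30 f01 f11 f21 g10 g20 g30 g01 g11 g21 g31 N1 N2 N3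
    have P0 := f00.symm
    have Q3 : Q 3 = 0 := by
      rw [N3] at g31
      simpa [hk'] using g31.symm
    have N1' : (k : ℂ) * (-Q 0 * Complex.cos (k * a) + (Q 1 * Complex.cos (k * b)
        + P 1 * Complex.sin (k * b)) + (Q 2 * Complex.cos (k * c) + P 2 * Complex.sin (k * c)))
        = 0 := by
      rw [g01, g10, g20, P0] at N1
      linear_combination N1
    have N2' : (k : ℂ) * (P 3 * Complex.sin (k * a) - (Q 1 * Complex.cos (k * b)
        - P 1 * Complex.sin (k * b)) - (Q 2 * Complex.cos (k * c) - P 2 * Complex.sin (k * c)))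
        = 0 := by
      rw [g11, g21, g30, Q3] at N2
      linear_combination N2
    have N1'' := (mul_eq_zero.1 N1').resolve_left hk'
    have N2'' := (mul_eq_zero.1 N2').resolve_left hk'
    rw [P0] at f01
    rw [Q3] at f30
    refine ⟨![Q 0, P 3, P 1, Q 1, P 2, Q 2], ?_, ?_⟩
    · simp only [IsCoeff, Matrix.cons_val, Complex.ofReal_cos, Complex.ofReal_sin,
        Complex.ofReal_mul]
      refine ⟨?_, ?_, ?_, ?_, ?_, ?_⟩
      · linear_combination f10 - f01
      · linear_combination f20 - f01
      · linear_combination f11 - f30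
      · linear_combination f21 - f30
      · linear_combination -N1''
      · linear_combination N2''
    · funext e x
      by_cases hx : x ∈ Set.Icc 0 ((![a, 2 * b, 2 * c, a] : Fin 4 → ℝ) e)
      · rw [ofCoeff_apply hx, (hPQ e x hx).1]
        fin_cases e <;> simp [P0, Q3]
      · rw [hsupp e x hx]
        exact if_neg hx
  · rintro ⟨v, ⟨h1, h2, h3, h4, h5, h6⟩, rfl⟩
    have hlen := (dihedralGraph a b c ha hb hc).length_pos
    refine ⟨fun e x hx => if_neg hx, fun e x => k * trig k ((![0, b, c, a] : Fin 4 → ℝ) e)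
      ((![v 0, v 3, v 5, 0] : Fin 4 → ℂ) e) (-(![0, v 2, v 4, v 1] : Fin 4 → ℂ) e) x,
      ![0, v 0 * (sin (k * a) : ℝ), v 1 * (cos (k * a) : ℝ), v 1], ?_, ?_, ?_, ?_, ?_, ?_⟩
    · intro e x hx
      exact (hasDerivAt_trig _ _ _ _ x).hasDerivWithinAt.congr
        (fun y hy => ofCoeff_apply hy) (ofCoeff_apply hx)
    · intro e x hx
      refine ((hasDerivAt_trig _ _ _ _ x).const_mul (k : ℂ)).hasDerivWithinAt.congr_deriv ?_
      rw [ofCoeff_apply hx]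
      simp only [trig]
      push_cast
      ring
    · intro e
      rw [ofCoeff_apply (Set.left_mem_Icc.2 (hlen e).le)]
      fin_cases e
      · simp [dihedralGraph, trig_zero]
      · simpa [dihedralGraph, trig_zero] using h1.symm
      · simpa [dihedralGraph, trig_zero] using h2.symm
      · simp [dihedralGraph, trig_zero]
    · intro e
      refine (ofCoeff_apply (Set.right_mem_Icc.2 (hlen e).le)).trans ?_
      fin_cases e
      · simp [dihedralGraph, trig_center_zero]
      · simpa [dihedralGraph, trig_two_mul] using h3.symm
      · simpa [dihedralGraph, trig_two_mul] using h4.symm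
      · simp [dihedralGraph, trig_self]
    · intro w hw
      obtain rfl : w = 0 := hw
      rfl
    · intro w hw
      simp only [Complex.ofReal_cos, Complex.ofReal_sin, Complex.ofReal_mul] at h5 h6
      fin_cases w
      · exact absurd rfl hw
      · simp [dihedralGraph, Fin.sum_univ_four, trig_zero, trig_center_zero]
        linear_combination (-(k : ℂ)) * h5
      · simp [dihedralGraph, Fin.sum_univ_four, trig_zero, trig_two_mul]
        linear_combination (k : ℂ) * h6
      · simp [dihedralGraph, Fin.sum_univ_four, trig_self]

theorem dihedralGraph_multiplicity_eq (ha : 0 < a) (hb : 0 < b) (hc : 0 < c) (hk : 0 < k) {d : ℕ}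
    (T : (Fin d → ℂ) →ₗ[ℂ] (Fin 6 → ℂ)) (hT : ∀ y, T y = 0 → y = 0)
    (h : ∀ v, IsCoeff a b c k v ↔ ∃ y, T y = v) :
    (dihedralGraph a b c ha hb hc).multiplicity (k ^ 2) = d := by
  have hinj : Function.Injective ((ofCoeff a b c k).comp T) :=
    (ofCoeff_injective ha hb hc hk).comp (LinearMap.ker_eq_bot.1 (LinearMap.ker_eq_bot'.2 hT))
  have hr : (dihedralGraph a b c ha hb hc).eigenspace (k ^ 2)
      = LinearMap.range ((ofCoeff a b c k).comp T) := by
    ext f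
    rw [mem_eigenspace_iff ha hb hc hk]
    constructor
    · rintro ⟨v, hv, rfl⟩
      obtain ⟨y, rfl⟩ := (h v).1 hv
      exact ⟨y, rfl⟩
    · rintro ⟨y, rfl⟩
      exact ⟨T y, (h _).2 ⟨y, rfl⟩, rfl⟩
  rw [QuantumGraph.multiplicity, hr, ← (LinearEquiv.ofInjective _ hinj).rank_eq, rank_fun']
  simp

/-- A nonzero real row `(α, β)` has kernel spanned, even over `ℂ`, by the real vector `(-β, α)`. A
simple eigenfunction is therefore a multiple of a real one, whose zeros can be counted by signs. -/
theorem exists_real_kernel {α β γ δ : ℝ} (h : α * δ - β * γ = 0)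
    (hne : ¬ (α = 0 ∧ β = 0 ∧ γ = 0 ∧ δ = 0)) : ∃ u₀ w₀ : ℝ, ¬ (u₀ = 0 ∧ w₀ = 0) ∧
      α * u₀ + β * w₀ = 0 ∧ γ * u₀ + δ * w₀ = 0 ∧
      ∀ u w : ℂ, α * u + β * w = 0 → γ * u + δ * w = 0 → ∃ t : ℂ, u = t * u₀ ∧ w = t * w₀ := by
  have main : ∀ {α β γ δ : ℝ}, α * δ - β * γ = 0 → ¬ (α = 0 ∧ β = 0) →
      ∃ u₀ w₀ : ℝ, ¬ (u₀ = 0 ∧ w₀ = 0) ∧ α * u₀ + β * w₀ = 0 ∧ γ * u₀ + δ * w₀ = 0 ∧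
      ∀ u w : ℂ, α * u + β * w = 0 → ∃ t : ℂ, u = t * u₀ ∧ w = t * w₀ := by
    intro α β γ δ h hne
    refine ⟨-β, α, fun h0 => hne ⟨h0.2, by linarith [h0.1]⟩, by ring, by linarith, ?_⟩
    intro u w h1
    have hpos : α ^ 2 + β ^ 2 ≠ 0 := fun h0 => hne
      ⟨by nlinarith [sq_nonneg α, sq_nonneg β], by nlinarith [sq_nonneg α, sq_nonneg β]⟩
    have hpos' : (α : ℂ) ^ 2 + (β : ℂ) ^ 2 ≠ 0 := by exact_mod_cast hpos
    refine ⟨(α * w - β * u) / (α ^ 2 + β ^ 2), ?_, ?_⟩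
    · push_cast
      field_simp
      linear_combination (α : ℂ) * h1
    · field_simp
      linear_combination (β : ℂ) * h1
  by_cases h1 : α = 0 ∧ β = 0
  · obtain ⟨u₀, w₀, h2, h3, h4, h5⟩ := main (α := γ) (β := δ) (γ := α) (δ := β)
      (by linarith) fun h0 => hne ⟨h1.1, h1.2, h0.1, h0.2⟩
    exact ⟨u₀, w₀, h2, h4, h3, fun u w _ h => h5 u w h⟩
  · obtain ⟨u₀, w₀, h2, h3, h4, h5⟩ := main h h1
    exact ⟨u₀, w₀, h2, h3, h4, fun u w h _ => h5 u w h⟩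

/-- The solution with a symmetric part `u` and an antisymmetric part `w` on the cycle. -/
noncomputable def ofParts (a b c k : ℝ) (u w : ℂ) : Fin 6 → ℂ :=
  ![(sin (k * a) * cos (k * b) * cos (k * c) + cos (k * a) * sin (k * (b + c)) : ℝ) * u +
      (cos (k * a) * sin (k * (b + c)) - sin (k * a) * sin (k * b) * sin (k * c) : ℝ) * w,
    (cos (k * a) * cos (k * b) * cos (k * c) - sin (k * a) * sin (k * (b + c)) : ℝ) * u +
      (cos (k * a) * sin (k * b) * sin (k * c) + sin (k * a) * sin (k * (b + c)) : ℝ) * w,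
    (cos (k * c) : ℝ) * u, (sin (k * c) : ℝ) * w, (cos (k * b) : ℝ) * u, (sin (k * b) : ℝ) * w]

theorem not_cos_and_cos (h : ¬ IsCycleFrequency b c k) :
    cos (k * b) ^ 2 + cos (k * c) ^ 2 ≠ 0 := by
  intro h0
  have h1 : cos (k * b) = 0 := by nlinarith [sq_nonneg (cos (k * b)), sq_nonneg (cos (k * c))]
  have h2 : cos (k * c) = 0 := by nlinarith [sq_nonneg (cos (k * b)), sq_nonneg (cos (k * c))]
  exact h ⟨by rw [mul_add, sin_add, h1, h2]; ring, by rw [sin_two_mul, h1]; ring⟩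

theorem not_sin_and_sin (h : ¬ IsCycleFrequency b c k) :
    sin (k * b) ^ 2 + sin (k * c) ^ 2 ≠ 0 := by
  intro h0
  have h1 : sin (k * b) = 0 := by nlinarith [sq_nonneg (sin (k * b)), sq_nonneg (sin (k * c))]
  have h2 : sin (k * c) = 0 := by nlinarith [sq_nonneg (sin (k * b)), sq_nonneg (sin (k * c))]
  exact h ⟨by rw [mul_add, sin_add, h1, h2]; ring, by rw [sin_two_mul, h1]; ring⟩

theorem IsCycleFrequency.cases (h : IsCycleFrequency b c k) :
    (cos (k * b) = 0 ∧ cos (k * c) = 0) ∨ (sin (k * b) = 0 ∧ sin (k * c) = 0) := by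
  obtain ⟨h1, h2⟩ := h
  rw [mul_add, sin_add] at h1
  rw [sin_two_mul] at h2
  have := sin_sq_add_cos_sq (k * b)
  rcases mul_eq_zero.1 h2 with h3 | h3
  · have h3 : sin (k * b) = 0 := by linarith
    rw [h3] at h1 this
    have : cos (k * b) ≠ 0 := by rintro h; rw [h] at this; norm_num at this
    refine Or.inr ⟨h3, ?_⟩
    simpa [this] using h1
  · rw [h3] at h1 this
    have : sin (k * b) ≠ 0 := by rintro h; rw [h] at this; norm_num at this
    refine Or.inl ⟨h3, ?_⟩
    simpa [this] using h1

/-- Continuity says that the even parts on the two cycle edges agree at the ends, and likewise the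
odd parts. This fixes each pair of coefficients up to a factor `u` or `w`. Rotating the remaining
equations by `ka` solves for the amplitudes on the leads and leaves two equations in `u` and `w`. -/
theorem isCoeff_iff_of_not_isCycleFrequency (h : ¬ IsCycleFrequency b c k) (v : Fin 6 → ℂ) :
    IsCoeff a b c k v ↔ ∃ u w : ℂ,
      (cos (k * a) * (cos (k * b) * cos (k * c)) - sin (k * a) * sin (k * (b + c)) : ℝ) * u +
        (-(cos (k * a) * (sin (k * b) * sin (k * c)) + sin (k * a) * sin (k * (b + c))) : ℝ) * w
        = 0 ∧
      (sin (k * a) * (cos (k * b) * cos (k * c)) + cos (k * a) * sin (k * (b + c)) : ℝ) * u +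
        (sin (k * a) * (sin (k * b) * sin (k * c)) - cos (k * a) * sin (k * (b + c)) : ℝ) * w
        = 0 ∧
      ofParts a b c k u w = v := by
  have hc' : ((cos (k * b) : ℝ) : ℂ) ^ 2 + ((cos (k * c) : ℝ) : ℂ) ^ 2 ≠ 0 := by
    exact_mod_cast not_cos_and_cos h
  have hs' : ((sin (k * b) : ℝ) : ℂ) ^ 2 + ((sin (k * c) : ℝ) : ℂ) ^ 2 ≠ 0 := by
    exact_mod_cast not_sin_and_sin h
  have ha : ((sin (k * a) : ℝ) : ℂ) ^ 2 + ((cos (k * a) : ℝ) : ℂ) ^ 2 = 1 := by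
    exact_mod_cast sin_sq_add_cos_sq (k * a)
  have hS : sin (k * (b + c)) = sin (k * b) * cos (k * c) + cos (k * b) * sin (k * c) := by
    rw [mul_add, sin_add]
  simp only [IsCoeff, ofParts, hS]
  push_cast [-Complex.ofReal_cos, -Complex.ofReal_sin]
  generalize ((sin (k * a) : ℝ) : ℂ) = sz at *
  generalize ((cos (k * a) : ℝ) : ℂ) = cz at *
  generalize ((sin (k * b) : ℝ) : ℂ) = sx at *
  generalize ((cos (k * b) : ℝ) : ℂ) = cx at *
  generalize ((sin (k * c) : ℝ) : ℂ) = sy at *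
  generalize ((cos (k * c) : ℝ) : ℂ) = cy at *
  constructor
  · rintro ⟨h1, h2, h3, h4, h5, h6⟩
    have e1 : v 2 * cx = v 4 * cy := by linear_combination (h2 + h4 - h1 - h3) / 2
    have e2 : v 3 * sx = v 5 * sy := by linear_combination (h4 - h3 + h1 - h2) / 2
    -- Either cosine may vanish alone, so `u` is found by projecting `(v 2, v 4)` onto `(cos kc, cos
    -- kb)`, which is nonzero; similarly for `w`.
    obtain ⟨u, hu⟩ : ∃ u, u = (v 2 * cy + v 4 * cx) / (cx ^ 2 + cy ^ 2) := ⟨_, rfl⟩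
    obtain ⟨w, hw⟩ : ∃ w, w = (v 3 * sy + v 5 * sx) / (sx ^ 2 + sy ^ 2) := ⟨_, rfl⟩
    have p2 : v 2 = cy * u := by
      rw [hu]; field_simp; linear_combination cx * e1
    have p4 : v 4 = cx * u := by
      rw [hu]; field_simp; linear_combination -cy * e1
    have p3 : v 3 = sy * w := by
      rw [hw]; field_simp; linear_combination sx * e2
    have p5 : v 5 = sx * w := by
      rw [hw]; field_simp; linear_combination -sy * e2
    rw [p2, p3] at h1 h3
    rw [p2, p3, p4, p5] at h5 h6
    refine ⟨u, w, ?_, ?_, ?_⟩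
    · linear_combination sz * h5 - cz * h1
    · linear_combination cz * h6 - sz * h3
    · ext i
      fin_cases i
      · simp
        linear_combination v 0 * ha - sz * h1 - cz * h5
      · simp
        linear_combination v 1 * ha - cz * h3 - sz * h6
      · simp [p2]
      · simp [p3]
      · simp [p4]
      · simp [p5]
  · rintro ⟨u, w, h1, h2, rfl⟩
    simp only [Matrix.cons_val]
    refine ⟨?_, ?_, ?_, ?_, ?_, ?_⟩
    · linear_combination (cx * cy * u - sx * sy * w) * ha - cz * h1
    · linear_combination (cx * cy * u - sx * sy * w) * ha - cz * h1
    · linear_combination (cx * cy * u + sx * sy * w) * ha - sz * h2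
    · linear_combination (cx * cy * u + sx * sy * w) * ha - sz * h2
    · linear_combination (sx * cy + cx * sy) * (u + w) * ha + sz * h1
    · linear_combination (sx * cy + cx * sy) * (w - u) * ha + cz * h2

theorem secular_eq_det (a b c k : ℝ) : secular a b c k =
    (cos (k * a) * (cos (k * b) * cos (k * c)) - sin (k * a) * sin (k * (b + c))) *
      (sin (k * a) * (sin (k * b) * sin (k * c)) - cos (k * a) * sin (k * (b + c))) -
    (-(cos (k * a) * (sin (k * b) * sin (k * c)) + sin (k * a) * sin (k * (b + c)))) *
      (sin (k * a) * (cos (k * b) * cos (k * c)) + cos (k * a) * sin (k * (b + c))) := by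
  have hC : cos (k * (b + c)) = cos (k * b) * cos (k * c) - sin (k * b) * sin (k * c) := by
    rw [mul_add, cos_add]
  rw [secular, phaseQ, sin_two_mul, sin_two_mul, sin_two_mul, cos_two_mul', hC]
  ring

/-- The system never has rank zero away from cycle frequencies, so its kernel is at most a line. -/
theorem matrix_ne_zero (h : ¬ IsCycleFrequency b c k) :
    ¬ (cos (k * a) * (cos (k * b) * cos (k * c)) - sin (k * a) * sin (k * (b + c)) = 0 ∧
      -(cos (k * a) * (sin (k * b) * sin (k * c)) + sin (k * a) * sin (k * (b + c))) = 0 ∧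
      sin (k * a) * (cos (k * b) * cos (k * c)) + cos (k * a) * sin (k * (b + c)) = 0 ∧
      sin (k * a) * (sin (k * b) * sin (k * c)) - cos (k * a) * sin (k * (b + c)) = 0) := by
  rintro ⟨h1, -, h3, -⟩
  have ha := sin_sq_add_cos_sq (k * a)
  have e1 : cos (k * b) * cos (k * c) = 0 := by
    linear_combination cos (k * a) * h1 + sin (k * a) * h3 - cos (k * b) * cos (k * c) * ha
  have e2 : sin (k * (b + c)) = 0 := by
    linear_combination cos (k * a) * h3 - sin (k * a) * h1 - sin (k * (b + c)) * ha
  refine h ⟨e2, ?_⟩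
  rw [mul_add, sin_add] at e2
  rw [sin_two_mul]
  rcases mul_eq_zero.1 e1 with e | e
  · rw [e]; ring
  · rw [e] at e2
    have h5 : cos (k * b) * sin (k * c) = 0 := by linarith
    have : sin (k * c) ≠ 0 := fun h0 => by
      have := sin_sq_add_cos_sq (k * c)
      rw [h0, e] at this
      norm_num at this
    rw [(mul_eq_zero.1 h5).resolve_right this]
    ring

theorem ofParts_eq_zero (h : ¬ IsCycleFrequency b c k) {u w : ℂ}
    (h0 : ofParts a b c k u w = 0) : u = 0 ∧ w = 0 := by
  have h2 : ((cos (k * c) : ℝ) : ℂ) * u = 0 := congrFun h0 2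
  have h3 : ((sin (k * c) : ℝ) : ℂ) * w = 0 := congrFun h0 3
  have h4 : ((cos (k * b) : ℝ) : ℂ) * u = 0 := congrFun h0 4
  have h5 : ((sin (k * b) : ℝ) : ℂ) * w = 0 := congrFun h0 5
  have hc' : ((cos (k * b) : ℝ) : ℂ) ^ 2 + ((cos (k * c) : ℝ) : ℂ) ^ 2 ≠ 0 := by
    exact_mod_cast not_cos_and_cos h
  have hs' : ((sin (k * b) : ℝ) : ℂ) ^ 2 + ((sin (k * c) : ℝ) : ℂ) ^ 2 ≠ 0 := by
    exact_mod_cast not_sin_and_sin h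
  constructor
  · refine (mul_eq_zero.1 (?_ : _ * u = 0)).resolve_left hc'
    linear_combination ((cos (k * c) : ℝ) : ℂ) * h2 + ((cos (k * b) : ℝ) : ℂ) * h4
  · refine (mul_eq_zero.1 (?_ : _ * w = 0)).resolve_left hs'
    linear_combination ((sin (k * c) : ℝ) : ℂ) * h3 + ((sin (k * b) : ℝ) : ℂ) * h5

theorem dihedralGraph_multiplicity_eq_zero (ha : 0 < a) (hb : 0 < b) (hc : 0 < c) (hk : 0 < k)
    (h : ¬ IsCycleFrequency b c k) (hs : secular a b c k ≠ 0) :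
    (dihedralGraph a b c ha hb hc).multiplicity (k ^ 2) = 0 := by
  refine dihedralGraph_multiplicity_eq ha hb hc hk (d := 0) 0 (fun y _ => Subsingleton.elim _ _) fun v => ?_
  rw [isCoeff_iff_of_not_isCycleFrequency h]
  have hs' := hs
  rw [secular_eq_det] at hs'
  have hs' := Complex.ofReal_ne_zero.2 hs'
  rw [Complex.ofReal_sub, Complex.ofReal_mul, Complex.ofReal_mul] at hs'
  constructor
  · rintro ⟨u, w, h1, h2, rfl⟩
    have hu : u = 0 := by
      refine (mul_eq_zero.1 (?_ : _ * u = 0)).resolve_left hs'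
      linear_combination ((sin (k * a) * (sin (k * b) * sin (k * c))
        - cos (k * a) * sin (k * (b + c)) : ℝ) : ℂ) * h1
        - ((-(cos (k * a) * (sin (k * b) * sin (k * c))
          + sin (k * a) * sin (k * (b + c))) : ℝ) : ℂ) * h2
    have hw : w = 0 := by
      refine (mul_eq_zero.1 (?_ : _ * w = 0)).resolve_left hs'
      linear_combination ((cos (k * a) * (cos (k * b) * cos (k * c))
        - sin (k * a) * sin (k * (b + c)) : ℝ) : ℂ) * h2
        - ((sin (k * a) * (cos (k * b) * cos (k * c))
          + cos (k * a) * sin (k * (b + c)) : ℝ) : ℂ) * h1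
    refine ⟨0, ?_⟩
    ext i
    fin_cases i <;> simp [ofParts, hu, hw]
  · rintro ⟨y, rfl⟩
    refine ⟨0, 0, by simp, by simp, ?_⟩
    ext i
    fin_cases i <;> simp [ofParts]

theorem isCoeff_iff_of_secular_eq_zero (h : ¬ IsCycleFrequency b c k)
    (hs : secular a b c k = 0) : ∃ u₀ w₀ : ℝ, ¬ (u₀ = 0 ∧ w₀ = 0) ∧ ∀ v,
      IsCoeff a b c k v ↔ ∃ t : ℂ, t • ofParts a b c k u₀ w₀ = v := by
  obtain ⟨u₀, w₀, h0, h1, h2, h3⟩ :=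
    exists_real_kernel ((secular_eq_det a b c k).symm.trans hs) (matrix_ne_zero h)
  have hsm : ∀ t : ℂ, t • ofParts a b c k u₀ w₀ = ofParts a b c k (t * u₀) (t * w₀) := fun t => by
    ext i
    fin_cases i <;> simp [ofParts] <;> ring
  refine ⟨u₀, w₀, h0, fun v => ?_⟩
  rw [isCoeff_iff_of_not_isCycleFrequency h]
  constructor
  · rintro ⟨u, w, e1, e2, rfl⟩
    obtain ⟨t, rfl, rfl⟩ := h3 u w e1 e2
    exact ⟨t, hsm t⟩
  · rintro ⟨t, rfl⟩
    refine ⟨t * u₀, t * w₀, ?_, ?_, (hsm t).symm⟩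
    · have := congrArg Complex.ofReal h1
      push_cast at this ⊢
      linear_combination t * this
    · have := congrArg Complex.ofReal h2
      push_cast at this ⊢
      linear_combination t * this

theorem dihedralGraph_multiplicity_eq_one (ha : 0 < a) (hb : 0 < b) (hc : 0 < c) (hk : 0 < k)
    (h : ¬ IsCycleFrequency b c k) (hs : secular a b c k = 0) :
    (dihedralGraph a b c ha hb hc).multiplicity (k ^ 2) = 1 := by
  obtain ⟨u₀, w₀, h0, hv⟩ := isCoeff_iff_of_secular_eq_zero h hs
  have hne : ofParts a b c k u₀ w₀ ≠ 0 := fun h1 => h0 (by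
    simpa using ofParts_eq_zero h h1)
  refine dihedralGraph_multiplicity_eq ha hb hc hk (d := 1)
    ((LinearMap.proj 0).smulRight (ofParts a b c k u₀ w₀)) (fun y hy => ?_) fun v => ?_
  · have : y 0 = 0 := by simpa [hne] using hy
    ext i
    rw [Subsingleton.elim i 0, this]
    rfl
  · rw [hv]
    exact ⟨fun ⟨t, ht⟩ => ⟨fun _ => t, ht⟩, fun ⟨y, hy⟩ => ⟨y 0, hy⟩⟩

/-! ### Multiplicities at cycle frequencies -/

/-- The eigenfunction supported on the cycle. -/
noncomputable def cycleCoeff (b c k : ℝ) : Fin 6 → ℂ :=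
  if cos (k * b) = 0 then ![0, 0, 1, 0, (-(sin (k * b) * sin (k * c)) : ℝ), 0]
  else ![0, 0, 0, 1, 0, (-(cos (k * b) * cos (k * c)) : ℝ)]

/-- The candidate with amplitude `1` on the Dirichlet lead, normalised to have no component at the
entry where `cycleCoeff` is `1`. It is a solution only if `cos (2ka) = 0`. -/
noncomputable def crossCoeff (a b c k : ℝ) : Fin 6 → ℂ :=
  if cos (k * b) = 0 then ![1, (-2 * sin (k * a) * cos (k * a) : ℝ), 0,
    (-(sin (k * a) * sin (k * b)) : ℝ), (cos (k * a) * sin (k * c) : ℝ),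
    (-(sin (k * a) * sin (k * c)) : ℝ)]
  else ![1, (2 * sin (k * a) * cos (k * a) : ℝ), (sin (k * a) * cos (k * b) : ℝ), 0,
    (sin (k * a) * cos (k * c) : ℝ), (cos (k * a) * cos (k * c) : ℝ)]

/-- At a cycle frequency the values at the two cycle vertices agree up to sign, and so do the
fluxes. The leads then behave like one interval of length `2a`, Dirichlet at one end and Neumann at
the other, which vibrates only if `cos (2ka) = 0`; the eigenfunction supported on the cycle comes in
addition. -/
theorem isCoeff_iff_of_isCycleFrequency (h : IsCycleFrequency b c k) (v : Fin 6 → ℂ) :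
    IsCoeff a b c k v ↔ v 0 * (cos (2 * (k * a)) : ℝ) = 0 ∧
      ∃ t : ℂ, t • cycleCoeff b c k + v 0 • crossCoeff a b c k = v := by
  have ha : ((sin (k * a) : ℝ) : ℂ) ^ 2 + ((cos (k * a) : ℝ) : ℂ) ^ 2 = 1 := by
    exact_mod_cast sin_sq_add_cos_sq (k * a)
  have hb : ((sin (k * b) : ℝ) : ℂ) ^ 2 + ((cos (k * b) : ℝ) : ℂ) ^ 2 = 1 := by
    exact_mod_cast sin_sq_add_cos_sq (k * b)
  have hc : ((sin (k * c) : ℝ) : ℂ) ^ 2 + ((cos (k * c) : ℝ) : ℂ) ^ 2 = 1 := by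
    exact_mod_cast sin_sq_add_cos_sq (k * c)
  rcases h.cases with ⟨hX, hY⟩ | ⟨hX, hY⟩
  · simp only [IsCoeff, cycleCoeff, crossCoeff, if_pos hX, cos_two_mul' (k * a)]
    rw [hX] at hb
    rw [hY] at hc
    rw [hX, hY]
    push_cast [-Complex.ofReal_cos, -Complex.ofReal_sin] at hb hc ⊢
    generalize ((sin (k * a) : ℝ) : ℂ) = sz at *
    generalize ((cos (k * a) : ℝ) : ℂ) = cz at *
    generalize ((sin (k * b) : ℝ) : ℂ) = sx at *
    generalize ((sin (k * c) : ℝ) : ℂ) = sy at *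
    have hx : sx ^ 2 = 1 := by linear_combination hb
    have hy : sy ^ 2 = 1 := by linear_combination hc
    constructor
    · rintro ⟨h1, h2, h3, h4, h5, h6⟩
      refine ⟨?_, v 2, ?_⟩
      · linear_combination cz * (h5 + h6) - sz * (h1 + h3)
      · ext i
        fin_cases i
        · simp
        · simp
          linear_combination -sz * (h5 + h6) - cz * (h1 + h3) + v 1 * ha
        · simp
        · simp
          linear_combination -sx * h1 + v 3 * hx
        · simp
          linear_combination sy * h5 + v 4 * hy
        · simp
          linear_combination -sy * h2 + v 5 * hy
    · rintro ⟨hc, t, ht⟩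
      have e1 := congrFun ht 1
      have e2 := congrFun ht 2
      have e3 := congrFun ht 3
      have e4 := congrFun ht 4
      have e5 := congrFun ht 5
      simp at e1 e2 e3 e4 e5
      rw [← e1, ← e2, ← e3, ← e4, ← e5]
      refine ⟨?_, ?_, ?_, ?_, ?_, ?_⟩
      · linear_combination -v 0 * sz * hx
      · linear_combination -v 0 * sz * hy
      · linear_combination v 0 * sz * hx - v 0 * sz * ha - sz * hc
      · linear_combination v 0 * sz * hy - v 0 * sz * ha - sz * hc
      · linear_combination (t * sx - v 0 * cz) * hy
      · linear_combination (v 0 * cz - t * sx) * hy - v 0 * cz * ha + cz * hc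
  · have hcos : cos (k * b) ≠ 0 := fun h0 => by
      rw [hX, h0] at hb
      norm_num at hb
    simp only [IsCoeff, cycleCoeff, crossCoeff, if_neg hcos, cos_two_mul' (k * a)]
    rw [hX] at hb
    rw [hY] at hc
    rw [hX, hY]
    push_cast [-Complex.ofReal_cos, -Complex.ofReal_sin] at hb hc ⊢
    generalize ((sin (k * a) : ℝ) : ℂ) = sz at *
    generalize ((cos (k * a) : ℝ) : ℂ) = cz at *
    generalize ((cos (k * b) : ℝ) : ℂ) = cx at *
    generalize ((cos (k * c) : ℝ) : ℂ) = cy at *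
    have hx : cx ^ 2 = 1 := by linear_combination hb
    have hy : cy ^ 2 = 1 := by linear_combination hc
    constructor
    · rintro ⟨h1, h2, h3, h4, h5, h6⟩
      refine ⟨?_, v 3, ?_⟩
      · linear_combination cz * (h5 - h6) - sz * (h1 - h3)
      · ext i
        fin_cases i
        · simp
        · simp
          linear_combination sz * (h5 - h6) + cz * (h1 - h3) + v 1 * ha
        · simp
          linear_combination cx * h1 + v 2 * hx
        · simp
        · simp
          linear_combination cy * h2 + v 4 * hy
        · simp
          linear_combination cy * h5 + v 5 * hy
    · rintro ⟨hc, t, ht⟩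
      have e1 := congrFun ht 1
      have e2 := congrFun ht 2
      have e3 := congrFun ht 3
      have e4 := congrFun ht 4
      have e5 := congrFun ht 5
      simp at e1 e2 e3 e4 e5
      rw [← e1, ← e2, ← e3, ← e4, ← e5]
      refine ⟨?_, ?_, ?_, ?_, ?_, ?_⟩
      · linear_combination -v 0 * sz * hx
      · linear_combination -v 0 * sz * hy
      · linear_combination -(v 0 * sz * hx - v 0 * sz * ha - sz * hc)
      · linear_combination -(v 0 * sz * hy - v 0 * sz * ha - sz * hc)
      · linear_combination (t * cx - v 0 * cz) * hy
      · linear_combination -((v 0 * cz - t * cx) * hy - v 0 * cz * ha + cz * hc)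

theorem dihedralGraph_multiplicity_of_isCycleFrequency (ha : 0 < a) (hb : 0 < b) (hc : 0 < c) (hk : 0 < k)
    (h : IsCycleFrequency b c k) : (dihedralGraph a b c ha hb hc).multiplicity (k ^ 2) =
      if cos (2 * (k * a)) = 0 then 2 else 1 := by
  have hcy : cycleCoeff b c k ≠ 0 := fun h0 => by
    unfold cycleCoeff at h0
    split_ifs at h0
    · simpa using congrFun h0 2
    · simpa using congrFun h0 3
  have hcy0 : cycleCoeff b c k 0 = 0 := by unfold cycleCoeff; split_ifs <;> rfl
  have hcr0 : crossCoeff a b c k 0 = 1 := by unfold crossCoeff; split_ifs <;> rfl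
  split_ifs with hcos
  · refine dihedralGraph_multiplicity_eq ha hb hc hk (d := 2) ((LinearMap.proj 0).smulRight (cycleCoeff b c k) +
      (LinearMap.proj 1).smulRight (crossCoeff a b c k)) (fun y hy => ?_) fun v => ?_
    · have hy' : y 0 • cycleCoeff b c k + y 1 • crossCoeff a b c k = 0 := hy
      have h1 : y 1 = 0 := by simpa [hcy0, hcr0] using congrFun hy' 0
      have h2 : y 0 = 0 := by simpa [h1, hcy] using hy'
      ext i
      fin_cases i
      · exact h2
      · exact h1
    · rw [isCoeff_iff_of_isCycleFrequency h, hcos]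
      constructor
      · rintro ⟨-, t, ht⟩
        exact ⟨![t, v 0], ht⟩
      · rintro ⟨y, rfl⟩
        refine ⟨by simp, y 0, ?_⟩
        simp [hcy0, hcr0]
  · refine dihedralGraph_multiplicity_eq ha hb hc hk (d := 1) ((LinearMap.proj 0).smulRight (cycleCoeff b c k))
      (fun y hy => ?_) fun v => ?_
    · have : y 0 = 0 := by simpa [hcy] using hy
      ext i
      rw [Subsingleton.elim i 0, this]
      rfl
    · rw [isCoeff_iff_of_isCycleFrequency h]
      constructor
      · rintro ⟨h1, t, ht⟩
        have h1 : v 0 = 0 := (mul_eq_zero.1 h1).resolve_right (Complex.ofReal_ne_zero.2 hcos)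
        rw [h1] at ht
        exact ⟨fun _ => t, by simpa using ht⟩
      · rintro ⟨y, rfl⟩
        have : (y 0 • cycleCoeff b c k) 0 = 0 := by simp [hcy0]
        refine ⟨?_, y 0, ?_⟩
        · simp [hcy0]
        · simp [hcy0]

end Coefficients

/-! ### Absence of nonpositive eigenvalues -/

section Energy

/-- The quantity `Re (conj f · f')` has derivative `|f'|² - lam |f|² ≥ 0`; if its increment is zero,
then `f'` vanishes. -/
theorem energy_le {l lam : ℝ} (hl : 0 < l) (hlam : lam ≤ 0) {f g : ℝ → ℂ}
    (hf : ∀ x ∈ Set.Icc 0 l, HasDerivWithinAt f (g x) (Set.Icc 0 l) x)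
    (hg : ∀ x ∈ Set.Icc 0 l, HasDerivWithinAt g (-((lam : ℂ) * f x)) (Set.Icc 0 l) x) :
    (f 0).re * (g 0).re + (f 0).im * (g 0).im ≤ (f l).re * (g l).re + (f l).im * (g l).im ∧
    ((f 0).re * (g 0).re + (f 0).im * (g 0).im = (f l).re * (g l).re + (f l).im * (g l).im →
      ∀ x ∈ Set.Icc 0 l, f x = f 0) := by
  set h : ℝ → ℝ := fun x => (f x).re * (g x).re + (f x).im * (g x).im with hh
  have hre : ∀ {u : ℝ → ℂ} {u' : ℂ} {x : ℝ}, HasDerivWithinAt u u' (Set.Icc 0 l) x →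
      HasDerivWithinAt (fun x => (u x).re) u'.re (Set.Icc 0 l) x := fun hu =>
    Complex.reCLM.hasFDerivAt.comp_hasDerivWithinAt _ hu
  have him : ∀ {u : ℝ → ℂ} {u' : ℂ} {x : ℝ}, HasDerivWithinAt u u' (Set.Icc 0 l) x →
      HasDerivWithinAt (fun x => (u x).im) u'.im (Set.Icc 0 l) x := fun hu =>
    Complex.imCLM.hasFDerivAt.comp_hasDerivWithinAt _ hu
  have hd : ∀ x ∈ Set.Icc 0 l, HasDerivWithinAt h
      ((g x).re ^ 2 + (g x).im ^ 2 + -lam * ((f x).re ^ 2 + (f x).im ^ 2)) (Set.Icc 0 l) x := by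
    intro x hx
    refine (((hre (hf x hx)).mul (hre (hg x hx))).add
      ((him (hf x hx)).mul (him (hg x hx)))).congr_deriv ?_
    simp
    ring
  have hmono : MonotoneOn h (Set.Icc 0 l) := by
    refine monotoneOn_of_hasDerivWithinAt_nonneg (convex_Icc 0 l)
      (fun x hx => (hd x hx).continuousWithinAt)
      (fun x hx => (hd x (interior_subset hx)).mono interior_subset) fun x _ => ?_
    have : 0 ≤ -lam * ((f x).re ^ 2 + (f x).im ^ 2) :=
      mul_nonneg (by linarith) (by positivity)
    positivity
  have h0 : (0 : ℝ) ∈ Set.Icc 0 l := Set.left_mem_Icc.2 hl.le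
  have h1 : l ∈ Set.Icc 0 l := Set.right_mem_Icc.2 hl.le
  refine ⟨hmono h0 h1 hl.le, fun heq x hx => ?_⟩
  have hconst : ∀ y ∈ Set.Icc 0 l, h y = h 0 := fun y hy =>
    le_antisymm ((hmono hy h1 hy.2).trans heq.ge) (hmono h0 hy hy.1)
  have hgz : ∀ y ∈ Set.Icc 0 l, g y = 0 := by
    intro y hy
    have e1 : HasDerivWithinAt h 0 (Set.Icc 0 l) y :=
      (hasDerivWithinAt_const y (Set.Icc 0 l) (h 0)).congr hconst (hconst y hy)
    have e2 := (uniqueDiffOn_Icc hl y hy).eq_deriv _ (hd y hy) e1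
    have e3 : 0 ≤ -lam * ((f y).re ^ 2 + (f y).im ^ 2) :=
      mul_nonneg (by linarith) (by positivity)
    apply Complex.ext
    · simp only [Complex.zero_re]; nlinarith [sq_nonneg (g y).re, sq_nonneg (g y).im]
    · simp only [Complex.zero_im]; nlinarith [sq_nonneg (g y).re, sq_nonneg (g y).im]
  have := (convex_Icc 0 l).norm_image_sub_le_of_norm_hasDerivWithin_le (C := 0) hf
    (fun y hy => by simp [hgz y hy]) h0 hx
  rw [zero_mul] at this
  exact sub_eq_zero.1 (norm_le_zero_iff.1 this)

theorem dihedralGraph_multiplicity_of_nonpos {a b c lam : ℝ} (ha : 0 < a) (hb : 0 < b)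
    (hc : 0 < c) (hlam : lam ≤ 0) : (dihedralGraph a b c ha hb hc).multiplicity lam = 0 := by
  have hbot : (dihedralGraph a b c ha hb hc).eigenspace lam = ⊥ := by
    rw [Submodule.eq_bot_iff]
    rintro f ⟨hsupp, g, F, hf, hg, hF0, hF1, hD, hN⟩
    have hlen := (dihedralGraph a b c ha hb hc).length_pos
    have hE := fun e => energy_le (hlen e) hlam (hf e) (hg e)
    have F0 := hD 0 (by simp [dihedralGraph])
    have N1 := hN 1 (by simp [dihedralGraph])
    have N2 := hN 2 (by simp [dihedralGraph])
    have N3 := hN 3 (by simp [dihedralGraph])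
    simp only [hF0, hF1] at hE
    have E0 := hE 0
    have E1 := hE 1
    have E2 := hE 2
    have E3 := hE 3
    have R0 := hF1 0
    have R1 := hF1 1
    have R3 := hF1 3
    have L0 := hF0 0
    have L1 := hF0 1
    have L2 := hF0 2
    have L3 := hF0 3
    simp [dihedralGraph, Fin.sum_univ_four, F0] at E0 E1 E2 E3 N1 N2 N3 R0 R1 R3 L0 L1 L2 L3
    have N1r := congrArg Complex.re N1
    have N1i := congrArg Complex.im N1
    have N2r := congrArg Complex.re N2
    have N2i := congrArg Complex.im N2
    simp at N1r N1i N2r N2i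
    rw [N3] at E3
    simp at E3
    -- Kirchhoff's conditions make the increments of the energy cancel in total. Each is
    -- nonnegative, so each is zero, and `f` is constant on every edge, starting from `0` at the
    -- Dirichlet vertex.
    have hsum : ((F 1).re * (g 0 a).re + (F 1).im * (g 0 a).im)
        + ((F 2).re * (g 1 (2 * b)).re + (F 2).im * (g 1 (2 * b)).im
          - ((F 1).re * (g 1 0).re + (F 1).im * (g 1 0).im))
        + ((F 2).re * (g 2 (2 * c)).re + (F 2).im * (g 2 (2 * c)).im
          - ((F 1).re * (g 2 0).re + (F 1).im * (g 2 0).im))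
        - ((F 2).re * (g 3 0).re + (F 2).im * (g 3 0).im) = 0 := by
      linear_combination -(F 1).re * N1r - (F 1).im * N1i - (F 2).re * N2r - (F 2).im * N2i
    obtain ⟨p0, q0⟩ := E0
    obtain ⟨p1, q1⟩ := E1
    obtain ⟨p2, q2⟩ := E2
    obtain ⟨p3, q3⟩ := E3
    have c0 := q0 (by linarith)
    have c1 := q1 (by linarith)
    have c2 := q2 (by linarith)
    have c3 := q3 (by linarith)
    have F1 : F 1 = 0 := by rw [← R0, c0 a ha.le le_rfl]
    have F2 : F 2 = 0 := by rw [← R1, c1 _ (by linarith) le_rfl, F1]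
    have hz : ∀ e, ∀ x ∈ (dihedralGraph a b c ha hb hc).edge e, f e x = 0 := by
      intro e x hx
      fin_cases e
      · exact c0 x hx.1 hx.2
      · exact (c1 x hx.1 hx.2).trans F1
      · exact (c2 x hx.1 hx.2).trans F1
      · exact (c3 x hx.1 hx.2).trans F2
    funext e x
    by_cases hx : x ∈ (dihedralGraph a b c ha hb hc).edge e
    · exact hz e x hx
    · exact hsupp e x hx
  rw [QuantumGraph.multiplicity, hbot, rank_bot]
  simp

end Energy

/-! ### Numbering the eigenvalues by phase levels -/

section Counting

theorem QuantumGraph.eigenvalueCount_eq {V E : Type*} [DecidableEq V] [Fintype E]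
    (Γ : QuantumGraph V E) (κ : ℕ → ℝ) (hfin : ∀ μ, {i | κ i = μ}.Finite)
    (h : ∀ μ, Γ.multiplicity μ = {i | κ i = μ}.encard) (S : Set ℝ) :
    Γ.eigenvalueCount S = {i | κ i ∈ S}.encard := by
  have hcard : ∀ μ, Γ.multiplicity μ = ({i | κ i = μ}.ncard : ℕ∞) := fun μ => by
    rw [h, (hfin μ).cast_ncard_eq]
  have e1 : ∀ μ, {i | κ i = μ} ≃ Fin ({i | κ i = μ}.ncard) := fun μ =>
    haveI := (hfin μ).to_subtype
    Finite.equivFinOfCardEq (Nat.card_coe_set_eq _)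
  let e : {i | κ i ∈ S} ≃ {p : ℝ × ℕ | p.1 ∈ S ∧ (p.2 : ℕ∞) < Γ.multiplicity p.1} :=
    { toFun := fun i => ⟨(κ i, e1 (κ i) ⟨i, rfl⟩), i.2, by
        rw [hcard]; exact_mod_cast (e1 (κ i) ⟨i, rfl⟩).2⟩
      invFun := fun p => ⟨(e1 p.1.1).symm ⟨p.1.2, by
          have := p.2.2
          rw [hcard] at this
          exact_mod_cast this⟩, by
        have := ((e1 p.1.1).symm ⟨p.1.2, by
          have := p.2.2
          rw [hcard] at this
          exact_mod_cast this⟩).2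
        rw [Set.mem_ofPred_eq] at this ⊢
        rw [this]
        exact p.2.1⟩
      left_inv := fun i => by simp
      right_inv := by
        rintro ⟨⟨μ, m⟩, hμ, hm⟩
        have key : ∀ x : {i | κ i = μ},
            ((κ x, (e1 (κ x) ⟨x, rfl⟩ : ℕ)) : ℝ × ℕ) = (μ, (e1 μ x : ℕ)) := by
          rintro ⟨x, rfl⟩
          rfl
        apply Subtype.ext
        have := key ((e1 μ).symm ⟨m, by
          rw [hcard] at hm
          exact_mod_cast hm⟩)
        simpa using this }
  exact (Set.encard_congr e).symm

variable {a b c k : ℝ}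

theorem phase_level_unique (ha : 0 < a) (hb : 0 < b) (hc : 0 < c) {s t l : ℝ}
    (hs : phaseLower a b c s ≤ l ∧ l ≤ phaseUpper a b c s)
    (ht : phaseLower a b c t ≤ l ∧ l ≤ phaseUpper a b c t) : s = t := by
  rcases lt_trichotomy s t with h | h | h
  · linarith [phaseUpper_lt_phaseLower ha hb hc h]
  · exact h
  · linarith [phaseUpper_lt_phaseLower ha hb hc h]

theorem pi_div_two_lt_phaseLower (ha : 0 < a) (hb : 0 < b) (hc : 0 < c) (hk : 0 < k) :
    π / 2 < phaseLower a b c k := by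
  have h := phaseUpper_lt_phaseLower ha hb hc hk
  have h0 : IsCycleFrequency b c 0 := by simp [IsCycleFrequency]
  rw [phaseUpper, if_pos h0, phase_of_isCycleFrequency h0] at h
  simpa using h

theorem exists_phase_eq (ha : 0 < a) (hb : 0 < b) (hc : 0 < c) (hk : 0 < k)
    (h : ¬ IsCycleFrequency b c k) (hs : secular a b c k = 0) :
    ∃ j : ℕ, phase a b c k = π * (j + 1) := by
  obtain ⟨m, hm⟩ := sin_eq_zero_iff.1 ((sin_phase_eq_zero_iff h).2 hs)
  have hpos := pi_div_two_lt_phaseLower ha hb hc hk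
  rw [phaseLower, if_neg h, ← hm] at hpos
  have hm0 : 0 < m := by
    have : (0 : ℝ) < m := by
      by_contra h0
      push Not at h0
      nlinarith [pi_pos]
    exact_mod_cast this
  refine ⟨m.toNat - 1, ?_⟩
  obtain ⟨j, rfl⟩ : ∃ j : ℕ, m = j + 1 := ⟨m.toNat - 1, by omega⟩
  rw [← hm]
  simp [mul_comm]

theorem cos_phase_of_isCycleFrequency (h : IsCycleFrequency b c k) :
    cos (phase a b c k) = cos (2 * (k * a)) := by
  have := sin_sq_add_cos_sq (k * (b + c))
  rw [phase_of_isCycleFrequency h, cos_add, cos_two_mul' (k * (b + c)), sin_two_mul (k * (b + c)),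
    h.1]
  rw [h.1] at this
  linear_combination cos (2 * (k * a)) * this

/-- A closed jump segment of length `π` contains one multiple of `π`, or two if its ends are
multiples themselves. The latter happens when `cos (phase a b c k) = cos (2ka)` is zero, exactly
when the eigenvalue is double. Elsewhere the segment is a point. -/
theorem multiplicity_eq_encard_levels (ha : 0 < a) (hb : 0 < b) (hc : 0 < c) (hk : 0 < k) :
    (dihedralGraph a b c ha hb hc).multiplicity (k ^ 2) =
      {j : ℕ | phaseLower a b c k ≤ π * (j + 1) ∧ π * (j + 1) ≤ phaseUpper a b c k}.encard := by
  have hpi := pi_pos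
  by_cases h : IsCycleFrequency b c k
  · have hpos := pi_div_two_lt_phaseLower ha hb hc hk
    rw [dihedralGraph_multiplicity_of_isCycleFrequency ha hb hc hk h,
      ← cos_phase_of_isCycleFrequency h]
    rw [phaseLower, if_pos h] at hpos
    rw [phaseLower, if_pos h, phaseUpper, if_pos h]
    split_ifs with hcos
    · obtain ⟨m, hm⟩ := cos_eq_zero_iff.1 hcos
      rw [hm] at hpos ⊢
      have hm0 : 0 < m := by
        have : (0 : ℝ) < m := by
          by_contra h0
          push Not at h0
          nlinarith
        exact_mod_cast this
      obtain ⟨j, rfl⟩ : ∃ j : ℕ, m = j + 1 := ⟨m.toNat - 1, by omega⟩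
      have : {i : ℕ | (2 * (((j : ℤ) + 1 : ℤ) : ℝ) + 1) * π / 2 - π / 2 ≤ π * (i + 1) ∧
          π * (i + 1) ≤ (2 * (((j : ℤ) + 1 : ℤ) : ℝ) + 1) * π / 2 + π / 2} = {j, j + 1} := by
        ext i
        simp only [Set.mem_ofPred_eq, Set.mem_insert_iff, Set.mem_singleton_iff]
        push_cast
        constructor
        · rintro ⟨h1, h2⟩
          have h1' : (j : ℝ) ≤ i := by nlinarith
          have h2' : (i : ℝ) ≤ j + 1 := by nlinarith
          have h1' : j ≤ i := by exact_mod_cast h1'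
          have h2' : i ≤ j + 1 := by exact_mod_cast h2'
          omega
        · rintro (rfl | rfl)
          · constructor <;> nlinarith
          · push_cast
            constructor <;> nlinarith
      rw [this, Set.encard_pair (by omega)]
    -- In units of `π` the segment is `[x, x + 1]` with `x` not an integer, so it holds only `⌈x⌉`.
    · set x := phase a b c k / π - 1 / 2 with hx
      have hxp : phase a b c k = π * (x + 1 / 2) := by rw [hx]; field_simp; ring
      have hxpos : 1 / 2 < x := by rw [hxp] at hpos; nlinarith
      have hne : (⌈x⌉ : ℝ) ≠ x := fun h0 => hcos (cos_eq_zero_iff.2 ⟨⌈x⌉, by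
        rw [hxp, h0]; ring⟩)
      have hc0 : 0 < ⌈x⌉ := Int.ceil_pos.2 (by linarith)
      obtain ⟨j, hj⟩ : ∃ j : ℕ, ⌈x⌉ = j + 1 := ⟨⌈x⌉.toNat - 1, by omega⟩
      have hlt : x < j + 1 := by
        have := lt_of_le_of_ne (Int.le_ceil x) hne.symm
        rw [hj] at this
        exact_mod_cast this
      have hgt : (j : ℝ) < x := by
        have := Int.ceil_lt_add_one x
        rw [hj] at this
        push_cast at this
        linarith
      have : {i : ℕ | phase a b c k - π / 2 ≤ π * (i + 1) ∧
          π * (i + 1) ≤ phase a b c k + π / 2} = {j} := by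
        ext i
        simp only [Set.mem_ofPred_eq, Set.mem_singleton_iff, hxp]
        constructor
        · rintro ⟨h1, h2⟩
          have h1' : (j : ℝ) < i + 1 := by nlinarith
          have h2' : (i : ℝ) < j + 1 := by nlinarith
          have h1' : j < i + 1 := by exact_mod_cast h1'
          have h2' : i < j + 1 := by exact_mod_cast h2'
          omega
        · rintro rfl
          constructor <;> nlinarith
      rw [this, Set.encard_singleton]
  · rw [phaseLower, if_neg h, phaseUpper, if_neg h]
    by_cases hs : secular a b c k = 0
    · obtain ⟨j, hj⟩ := exists_phase_eq ha hb hc hk h hs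
      rw [dihedralGraph_multiplicity_eq_one ha hb hc hk h hs, hj]
      have : {i : ℕ | π * ((j : ℝ) + 1) ≤ π * (i + 1) ∧ π * ((i : ℝ) + 1) ≤ π * (j + 1)}
          = {j} := by
        ext i
        simp only [Set.mem_ofPred_eq, Set.mem_singleton_iff, mul_le_mul_iff_right₀ hpi,
          add_le_add_iff_right, Nat.cast_le]
        omega
      rw [this, Set.encard_singleton]
    · rw [dihedralGraph_multiplicity_eq_zero ha hb hc hk h hs, eq_comm, Set.encard_eq_zero,
        Set.eq_empty_iff_forall_notMem]
      rintro i ⟨h1, h2⟩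
      refine hs ((sin_phase_eq_zero_iff h).1 ?_)
      rw [le_antisymm h1 h2, sin_eq_zero_iff]
      exact ⟨i + 1, by push_cast; ring⟩

/-- If `κ i` is the point where level `π(i + 1)` is met, then the `κ i ^ 2` list the eigenvalues in
order with multiplicity. -/
theorem phase_eq_of_isNthEigenvalue (ha : 0 < a) (hb : 0 < b) (hc : 0 < c) (hk : 0 < k) {n : ℕ}
    (hn : (dihedralGraph a b c ha hb hc).IsNthEigenvalue n (k ^ 2))
    (h : ¬ IsCycleFrequency b c k) (hs : secular a b c k = 0) :
    phase a b c k = π * n := by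
  have hpi := pi_pos
  have hex : ∀ i : ℕ, ∃ t, 0 < t ∧ phaseLower a b c t ≤ π * (i + 1) ∧
      π * (i + 1) ≤ phaseUpper a b c t := fun i =>
    exists_phase_level ha hb hc (by nlinarith [(Nat.cast_nonneg i : (0 : ℝ) ≤ i)])
  choose κ hκ0 hκ using hex
  have hfib : ∀ t, 0 < t → {i | κ i ^ 2 = t ^ 2} =
      {j : ℕ | phaseLower a b c t ≤ π * (j + 1) ∧ π * (j + 1) ≤ phaseUpper a b c t} := by
    intro t ht
    ext i
    simp only [Set.mem_ofPred_eq]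
    rw [sq_eq_sq₀ (hκ0 i).le ht.le]
    constructor
    · rintro rfl
      exact hκ i
    · exact fun hi => phase_level_unique ha hb hc (hκ i) hi
  have hneg : ∀ μ : ℝ, μ ≤ 0 → {i | κ i ^ 2 = μ} = ∅ := fun μ hμ => by
    rw [Set.eq_empty_iff_forall_notMem]
    rintro i (hi : κ i ^ 2 = μ)
    have := pow_pos (hκ0 i) 2
    linarith
  have hmult : ∀ μ, (dihedralGraph a b c ha hb hc).multiplicity μ
      = {i | κ i ^ 2 = μ}.encard := by
    intro μ
    rcases le_or_gt μ 0 with hμ | hμ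
    · rw [hneg μ hμ, dihedralGraph_multiplicity_of_nonpos ha hb hc hμ, Set.encard_empty]
    · rw [← sq_sqrt hμ.le, hfib _ (sqrt_pos.2 hμ),
        multiplicity_eq_encard_levels ha hb hc (sqrt_pos.2 hμ)]
  have hfin : ∀ μ, {i | κ i ^ 2 = μ}.Finite := by
    intro μ
    rcases le_or_gt μ 0 with hμ | hμ
    · rw [hneg μ hμ]
      exact Set.finite_empty
    · rw [← sq_sqrt hμ.le, hfib _ (sqrt_pos.2 hμ)]
      refine (Set.finite_Iic ⌈phaseUpper a b c √μ / π⌉₊).subset fun i hi => ?_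
      have h1 : (i : ℝ) ≤ phaseUpper a b c √μ / π := by
        rw [le_div_iff₀ hpi]
        linarith [hi.2]
      exact Nat.cast_le.1 (h1.trans (Nat.le_ceil _))
  have hcount := QuantumGraph.eigenvalueCount_eq _ (fun i => κ i ^ 2) hfin hmult
  obtain ⟨j, hj⟩ := exists_phase_eq ha hb hc hk h hs
  have hL : phaseLower a b c k = π * (j + 1) := by rw [phaseLower, if_neg h, hj]
  have hU : phaseUpper a b c k = π * (j + 1) := by rw [phaseUpper, if_neg h, hj]
  have hlt : ∀ i, κ i < k ↔ i < j := by
    intro i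
    rw [← Nat.cast_lt (α := ℝ)]
    constructor
    · intro hi
      have := phaseUpper_lt_phaseLower ha hb hc hi
      nlinarith [(hκ i).2]
    · intro hi
      by_contra hcon
      rcases (not_lt.1 hcon).eq_or_lt with h1 | h1
      · have := (hκ i).1
        rw [← h1, hL] at this
        nlinarith
      · have := phaseUpper_lt_phaseLower ha hb hc h1
        nlinarith [(hκ i).1]
  have hle : ∀ i, κ i ≤ k ↔ i ≤ j := by
    intro i
    rw [← Nat.cast_le (α := ℝ)]
    constructor
    · intro hi
      rcases hi.eq_or_lt with h1 | h1
      · have := (hκ i).2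
        rw [h1, hU] at this
        nlinarith
      · exact_mod_cast ((hlt i).1 h1).le
    · intro hi
      by_contra hcon
      have := phaseUpper_lt_phaseLower ha hb hc (not_le.1 hcon)
      nlinarith [(hκ i).1]
  obtain ⟨hn1, hn2⟩ := hn
  rw [hcount] at hn1 hn2
  have s1 : {i | κ i ^ 2 ∈ Set.Iio (k ^ 2)} = (Finset.range j : Set ℕ) := by
    ext i
    simp [pow_lt_pow_iff_left₀ (hκ0 i).le hk.le, hlt]
  have s2 : {i | κ i ^ 2 ∈ Set.Iic (k ^ 2)} = (Finset.range (j + 1) : Set ℕ) := by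
    ext i
    simp [pow_le_pow_iff_left₀ (hκ0 i).le hk.le, hle]
  rw [s1, Set.encard_coe_eq_coe_finsetCard, Finset.card_range] at hn1
  rw [s2, Set.encard_coe_eq_coe_finsetCard, Finset.card_range] at hn2
  have hn1 : j < n := by exact_mod_cast hn1
  have hn2 : n ≤ j + 1 := by exact_mod_cast hn2
  -- Exactly `j` eigenvalues lie below `k ^ 2` and `j + 1` do not exceed it, the levels being
  -- numbered from `0`.
  obtain rfl : n = j + 1 := by omega
  rw [hj]
  push_cast
  ring

end Counting

/-! ### Integer parts and signs of sines -/

section Floor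

theorem sin_pi_mul_eq (t : ℝ) : sin (π * t) = (-1) ^ ⌊t⌋ * sin (π * Int.fract t) := by
  rw [← sin_add_int_mul_pi]
  congr 1
  rw [Int.fract]
  ring

theorem sin_pi_mul_fract_nonneg (t : ℝ) : 0 ≤ sin (π * Int.fract t) :=
  sin_nonneg_of_nonneg_of_le_pi (mul_nonneg pi_pos.le (Int.fract_nonneg t))
    (by nlinarith [pi_pos, Int.fract_lt_one t])

theorem even_floor_add_floor {s t : ℝ} (h : 0 < sin (π * s) * sin (π * t)) :
    Even (⌊s⌋ + ⌊t⌋) := by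
  rw [sin_pi_mul_eq s, sin_pi_mul_eq t] at h
  by_contra hodd
  have h1 : ((-1 : ℝ) ^ ⌊s⌋) * (-1) ^ ⌊t⌋ = -1 := by
    rw [← zpow_add₀ (by norm_num), (Int.not_even_iff_odd.1 hodd).neg_one_zpow]
  have h2 := mul_nonneg (sin_pi_mul_fract_nonneg s) (sin_pi_mul_fract_nonneg t)
  have h3 : (-1 : ℝ) ^ ⌊s⌋ * sin (π * Int.fract s) * ((-1) ^ ⌊t⌋ * sin (π * Int.fract t)) =
      -(sin (π * Int.fract s) * sin (π * Int.fract t)) := by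
    linear_combination (sin (π * Int.fract s) * sin (π * Int.fract t)) * h1
  linarith

theorem floor_lt_of_sin_ne_zero {t : ℝ} (h : sin (π * t) ≠ 0) : (⌊t⌋ : ℝ) < t :=
  lt_of_le_of_ne (Int.floor_le t) fun h0 => h (sin_eq_zero_iff.2 ⟨⌊t⌋, by rw [h0]; ring⟩)

/-- For `t = 2ka/π` the two terms on the left count the zeros on the Dirichlet lead and, with its
sign, on the Neumann lead. -/
theorem floor_half_sub_floor {t : ℝ} (h : (⌊t⌋ : ℝ) < t) :
    ⌊t / 2⌋ - ⌊1 / 2 - t / 2⌋ = ⌊t⌋ := by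
  have h1 := Int.floor_le (t / 2)
  have h2 := Int.lt_floor_add_one (t / 2)
  have h3 := Int.floor_le (1 / 2 - t / 2)
  have h4 := Int.lt_floor_add_one (1 / 2 - t / 2)
  have h5 := Int.lt_floor_add_one t
  have e1 : ((2 * ⌊t / 2⌋ : ℤ) : ℝ) < (⌊t⌋ + 1 : ℤ) := by push_cast; linarith
  have e2 : ((⌊t⌋ : ℤ) : ℝ) < (2 * ⌊t / 2⌋ + 2 : ℤ) := by push_cast; linarith
  have e3 : ((⌊t⌋ - 1 : ℤ) : ℝ) < (-2 * ⌊1 / 2 - t / 2⌋ : ℤ) := by push_cast; linarith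
  have e4 : ((-2 * ⌊1 / 2 - t / 2⌋ : ℤ) : ℝ) < (⌊t⌋ + 2 : ℤ) := by push_cast; linarith
  have e1 := Int.cast_lt.1 e1
  have e2 := Int.cast_lt.1 e2
  have e3 := Int.cast_lt.1 e3
  have e4 := Int.cast_lt.1 e4
  omega

/-- The carries `⌊u₁ + u₂⌋ - ⌊u₁⌋ - ⌊u₂⌋` and `⌊v₁ + v₂⌋ - ⌊v₁⌋ - ⌊v₂⌋` lie in `{0, 1}` and, by the
hypotheses, have equal parity. They are therefore equal, and the sum is `⌊v₁ + v₂⌋ - ⌊u₁ + u₂⌋`. -/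
theorem floor_sub_add_floor_sub {u₁ u₂ v₁ v₂ : ℝ} (h0 : Even (⌊u₁⌋ + ⌊u₂⌋))
    (h1 : Even (⌊v₁⌋ + ⌊v₂⌋)) (h2 : Even (⌊u₁ + u₂⌋ + ⌊v₁ + v₂⌋)) :
    Even ((⌊v₁⌋ - ⌊u₁⌋) + (⌊v₂⌋ - ⌊u₂⌋)) ∧
    (⌊v₁⌋ - ⌊u₁⌋) + (⌊v₂⌋ - ⌊u₂⌋) - ⌊(v₁ + v₂) - (u₁ + u₂)⌋ ∈ Set.Icc (0 : ℤ) 1 := by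
  have a1 := Int.le_floor_add u₁ u₂
  have a2 := Int.le_floor_add_floor u₁ u₂
  have a3 := Int.le_floor_add v₁ v₂
  have a4 := Int.le_floor_add_floor v₁ v₂
  have a5 := Int.le_floor_add ((v₁ + v₂) - (u₁ + u₂)) (u₁ + u₂)
  have a6 := Int.le_floor_add_floor ((v₁ + v₂) - (u₁ + u₂)) (u₁ + u₂)
  rw [sub_add_cancel] at a5 a6
  rw [Int.even_iff] at *
  refine ⟨by omega, ?_, ?_⟩ <;> omega

theorem floor_eq_of_close {s t : ℝ} (h : 0 < sin (π * s) * sin (π * t)) (hst : |s - t| < 1) :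
    ⌊s⌋ = ⌊t⌋ := by
  have h1 := (Int.even_iff).1 (even_floor_add_floor h)
  obtain ⟨h2, h3⟩ := abs_lt.1 hst
  have b1 := Int.floor_le s
  have b2 := Int.lt_floor_add_one s
  have b3 := Int.floor_le t
  have b4 := Int.lt_floor_add_one t
  have e1 : ((⌊s⌋ : ℤ) : ℝ) < (⌊t⌋ + 2 : ℤ) := by push_cast; linarith
  have e2 : ((⌊t⌋ : ℤ) : ℝ) < (⌊s⌋ + 2 : ℤ) := by push_cast; linarith
  have e1 := Int.cast_lt.1 e1
  have e2 := Int.cast_lt.1 e2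
  omega

/-- If `n = ζ + μ + η`, where `μ` and `μ + η` have the same integral part, this is also the
integral part of `n μ / (ζ + μ)`. -/
theorem floor_mul_ratio {ζ μ η n : ℝ} (hζ : 0 < ζ) (hμ : 0 < μ) (hn : n = ζ + μ + η)
    (h : ⌊μ + η⌋ = ⌊μ⌋) : ⌊μ / (ζ + μ) * n⌋ = ⌊μ⌋ := by
  have h1 := Int.floor_le μ
  have h2 := Int.lt_floor_add_one μ
  have h3 := Int.floor_le (μ + η)
  have h4 := Int.lt_floor_add_one (μ + η)
  rw [h] at h3 h4
  set r := μ / (ζ + μ) with hr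
  have hr0 : 0 < r := by positivity
  have hr1 : r < 1 := by rw [hr, div_lt_one (by positivity)]; linarith
  -- A convex combination of two numbers with the same integral part.
  have e : r * n = (1 - r) * μ + r * (μ + η) := by
    have : r * (ζ + μ) = μ := by rw [hr]; field_simp
    rw [hn]
    linear_combination this
  rw [Int.floor_eq_iff, e]
  constructor <;> nlinarith

end Floor

/-! ### Counting zeros of sines -/

section Zeros

theorem ncard_zeros_sin {k l p : ℝ} (hk : 0 < k) (hl : 0 < l) (h : sin (π * p + k * l) ≠ 0) :
    {x | x ∈ Set.Ioo 0 l ∧ sin (π * p + k * x) = 0}.Finite ∧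
    ({x | x ∈ Set.Ioo 0 l ∧ sin (π * p + k * x) = 0}.ncard : ℤ) = ⌊p + k * l / π⌋ - ⌊p⌋ := by
  have hpi := pi_pos
  have hq : (⌊p + k * l / π⌋ : ℝ) < p + k * l / π := by
    refine floor_lt_of_sin_ne_zero ?_
    rwa [mul_add, mul_div_cancel₀ _ hpi.ne']
  -- Excluding the left end of the integer interval discards a possible zero at `x = 0`, as at the
  -- Dirichlet vertex; the right end is harmless by `h`.
  have hset : {x | x ∈ Set.Ioo 0 l ∧ sin (π * p + k * x) = 0} =
      (fun j : ℤ => (j - p) * π / k) '' (Finset.Ioc ⌊p⌋ ⌊p + k * l / π⌋ : Set ℤ) := by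
    ext x
    simp only [Set.mem_ofPred_eq, Set.mem_image, Finset.coe_Ioc, Set.mem_Ioc, Int.floor_lt,
      Int.le_floor]
    constructor
    · rintro ⟨⟨h0, h1⟩, h2⟩
      obtain ⟨j, hj⟩ := sin_eq_zero_iff.1 h2
      have hjp : (j - p) * π = k * x := by linear_combination hj
      refine ⟨j, ⟨?_, ?_⟩, ?_⟩
      · have : 0 < (j - p) * π := by rw [hjp]; positivity
        have := pos_of_mul_pos_left this hpi.le
        linarith
      · have : (j - p) * π ≤ k * l := by rw [hjp]; gcongr
        have := (le_div_iff₀ hpi).2 this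
        linarith
      · rw [hjp]; field_simp
    · rintro ⟨j, ⟨h0, h1⟩, rfl⟩
      have h1' : (j : ℝ) < p + k * l / π := lt_of_le_of_lt
        (by exact_mod_cast Int.le_floor.2 h1) hq
      refine ⟨⟨?_, ?_⟩, ?_⟩
      · have : 0 < (j : ℝ) - p := by linarith
        positivity
      · rw [div_lt_iff₀ hk, mul_comm l, ← lt_div_iff₀ hpi]
        linarith
      · rw [sin_eq_zero_iff]
        refine ⟨j, ?_⟩
        field_simp
        ring
  have hinj : Function.Injective fun j : ℤ => ((j : ℝ) - p) * π / k := by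
    intro i j hij
    simp only at hij
    field_simp at hij
    have : (i : ℝ) = j := by linarith
    exact_mod_cast this
  rw [hset]
  refine ⟨(Finset.finite_toSet _).image _, ?_⟩
  rw [Set.ncard_image_of_injective _ hinj, Set.ncard_coe_finset, Int.card_Ioc]
  have : ⌊p⌋ ≤ ⌊p + k * l / π⌋ := Int.floor_mono (by
    have : 0 < k * l / π := by positivity
    linarith)
  omega

theorem ncard_eq_sum_fibers {E α : Type*} [Fintype E] (S : Set (E × α))
    (h : ∀ e, {x | (e, x) ∈ S}.Finite) :
    S.Finite ∧ S.ncard = ∑ e, {x | (e, x) ∈ S}.ncard := by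
  classical
  have hS : S = ⋃ e, Prod.mk e '' {x | (e, x) ∈ S} := by
    ext ⟨e, x⟩
    simp
  have hfin : S.Finite := by
    rw [hS]
    exact Set.finite_iUnion fun e => (h e).image _
  refine ⟨hfin, ?_⟩
  rw [Set.ncard_eq_toFinset_card S hfin,
    Finset.card_eq_sum_card_fiberwise (f := Prod.fst) (t := Finset.univ) (by simp)]
  refine Finset.sum_congr rfl fun e _ => ?_
  rw [← Set.ncard_coe_finset, ← Set.ncard_image_of_injective {x | (e, x) ∈ S}
    (Prod.mk_right_injective e)]
  refine congrArg Set.ncard (Set.ext ?_)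
  rintro ⟨e', x⟩
  simp only [Finset.coe_filter, Set.Finite.mem_toFinset, Set.mem_ofPred_eq, Set.mem_image,
    Prod.mk.injEq]
  constructor
  · rintro ⟨h1, rfl⟩
    exact ⟨x, h1, rfl, rfl⟩
  · rintro ⟨y, h1, rfl, rfl⟩
    exact ⟨h1, rfl⟩

theorem exists_amplitude_phase (k x₀ : ℝ) {P Q : ℝ} (h : ¬ (P = 0 ∧ Q = 0)) :
    ∃ ρ u : ℝ, 0 < ρ ∧ ∀ x,
      P * cos (k * (x - x₀)) + Q * sin (k * (x - x₀)) = ρ * sin (π * u + k * x) ∧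
      Q * cos (k * (x - x₀)) - P * sin (k * (x - x₀)) = ρ * cos (π * u + k * x) := by
  set z : ℂ := ⟨Q, P⟩ with hz
  have hz0 : z ≠ 0 := fun h0 => h ⟨congrArg Complex.im h0, congrArg Complex.re h0⟩
  have h1 : ‖z‖ * cos z.arg = Q := Complex.norm_mul_cos_arg z
  have h2 : ‖z‖ * sin z.arg = P := Complex.norm_mul_sin_arg z
  refine ⟨‖z‖, (z.arg - k * x₀) / π, norm_pos_iff.2 hz0, fun x => ?_⟩
  have e : π * ((z.arg - k * x₀) / π) + k * x = z.arg + k * (x - x₀) := by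
    rw [mul_div_cancel₀ _ pi_pos.ne']
    ring
  rw [e, sin_add, cos_add]
  constructor
  · linear_combination -cos (k * (x - x₀)) * h2 - sin (k * (x - x₀)) * h1
  · linear_combination -cos (k * (x - x₀)) * h1 + sin (k * (x - x₀)) * h2

end Zeros

/-! ### The nodal count on leads and cycle -/

section Nodal

variable {a b c k : ℝ}

/-- The number of zeros of a real eigenfunction with given coefficients. -/
theorem ncard_zeros_ofCoeff (ha : 0 < a) (hb : 0 < b) (hc : 0 < c) (hk : 0 < k) (r : Fin 6 → ℝ)
    (hr : IsCoeff a b c k fun i => (r i : ℂ)) (hF₁ : r 0 * sin (k * a) ≠ 0)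
    (hF₂ : r 1 * cos (k * a) ≠ 0) {t : ℂ} (ht : t ≠ 0) :
    ((dihedralGraph a b c ha hb hc).zeros (ofCoeff a b c k (t • fun i => (r i : ℂ)))).Finite ∧
    ∃ Z : ℤ, Even Z ∧ Z - ⌊2 * (k * (b + c)) / π⌋ ∈ Set.Icc (0 : ℤ) 1 ∧
    (((dihedralGraph a b c ha hb hc).zeros
      (ofCoeff a b c k (t • fun i => (r i : ℂ)))).ncard : ℤ) = ⌊2 * (k * a) / π⌋ + Z := by
  have hpi := pi_pos
  obtain ⟨h1, h2, h3, h4, h5, h6⟩ := hr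
  beta_reduce at h1 h2 h3 h4 h5 h6
  norm_cast at h1 h2 h3 h4 h5 h6
  have hA := (mul_ne_zero_iff.1 hF₁).1
  have hs := (mul_ne_zero_iff.1 hF₁).2
  have hB := (mul_ne_zero_iff.1 hF₂).1
  have hcz := (mul_ne_zero_iff.1 hF₂).2
  have hn1 : ¬ (r 2 = 0 ∧ r 3 = 0) := fun h => hF₁ (by rw [h1, h.1, h.2]; ring)
  have hn2 : ¬ (r 4 = 0 ∧ r 5 = 0) := fun h => hF₁ (by rw [h2, h.1, h.2]; ring)
  obtain ⟨ρ₁, u₁, hρ₁, e₁⟩ := exists_amplitude_phase k b hn1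
  obtain ⟨ρ₂, u₂, hρ₂, e₂⟩ := exists_amplitude_phase k c hn2
  have s1 := e₁ 0
  have s2 := e₂ 0
  have t1 := e₁ (2 * b)
  have t2 := e₂ (2 * c)
  rw [show (2 * b - b) = b by ring] at t1
  rw [show (2 * c - c) = c by ring] at t2
  simp only [zero_sub, mul_neg, cos_neg, sin_neg, mul_zero, add_zero] at s1 s2
  set v₁ := u₁ + k * (2 * b) / π with hv₁
  set v₂ := u₂ + k * (2 * c) / π with hv₂
  have hv₁' : π * u₁ + k * (2 * b) = π * v₁ := by rw [hv₁]; field_simp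
  have hv₂' : π * u₂ + k * (2 * c) = π * v₂ := by rw [hv₂]; field_simp
  rw [hv₁'] at t1
  rw [hv₂'] at t2
  have f1 : ρ₁ * sin (π * u₁) = r 0 * sin (k * a) := by linarith [s1.1]
  have f2 : ρ₂ * sin (π * u₂) = r 0 * sin (k * a) := by linarith [s2.1]
  have g1 : ρ₁ * sin (π * v₁) = r 1 * cos (k * a) := by linarith [t1.1]
  have g2 : ρ₂ * sin (π * v₂) = r 1 * cos (k * a) := by linarith [t2.1]
  have d1 : ρ₁ * cos (π * u₁) + ρ₂ * cos (π * u₂) = r 0 * cos (k * a) := by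
    linarith [s1.2, s2.2]
  have d2 : ρ₁ * cos (π * v₁) + ρ₂ * cos (π * v₂) = r 1 * sin (k * a) := by
    linarith [t1.2, t2.2]
  have hρ : 0 < ρ₁ * ρ₂ := mul_pos hρ₁ hρ₂
  have p0 : 0 < sin (π * u₁) * sin (π * u₂) := by
    refine pos_of_mul_pos_right (a := ρ₁ * ρ₂) ?_ hρ.le
    have : ρ₁ * ρ₂ * (sin (π * u₁) * sin (π * u₂)) = (r 0 * sin (k * a)) ^ 2 := by
      rw [sq]; nth_rw 1 [← f1]; rw [← f2]; ring
    rw [this]; positivity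
  have p1 : 0 < sin (π * v₁) * sin (π * v₂) := by
    refine pos_of_mul_pos_right (a := ρ₁ * ρ₂) ?_ hρ.le
    have : ρ₁ * ρ₂ * (sin (π * v₁) * sin (π * v₂)) = (r 1 * cos (k * a)) ^ 2 := by
      rw [sq]; nth_rw 1 [← g1]; rw [← g2]; ring
    rw [this]; positivity
  -- By the addition formula this is the value of `f` at `v₁` times its normalised flux into the
  -- cycle. The analogue at `v₂` has the same factor `sin ka cos ka`, hence the same sign.
  have q0 : ρ₁ * ρ₂ * sin (π * (u₁ + u₂)) = r 0 ^ 2 * (sin (k * a) * cos (k * a)) := by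
    rw [mul_add, sin_add]
    linear_combination ρ₂ * cos (π * u₂) * f1 + ρ₁ * cos (π * u₁) * f2
      + r 0 * sin (k * a) * d1
  have q1 : ρ₁ * ρ₂ * sin (π * (v₁ + v₂)) = r 1 ^ 2 * (sin (k * a) * cos (k * a)) := by
    rw [mul_add, sin_add]
    linear_combination ρ₂ * cos (π * v₂) * g1 + ρ₁ * cos (π * v₁) * g2
      + r 1 * cos (k * a) * d2
  have p2 : 0 < sin (π * (u₁ + u₂)) * sin (π * (v₁ + v₂)) := by
    refine pos_of_mul_pos_right (a := (ρ₁ * ρ₂) ^ 2) ?_ (sq_nonneg _)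
    have : (ρ₁ * ρ₂) ^ 2 * (sin (π * (u₁ + u₂)) * sin (π * (v₁ + v₂)))
        = (r 0 * r 1 * (sin (k * a) * cos (k * a))) ^ 2 := by
      linear_combination (ρ₁ * ρ₂ * sin (π * (v₁ + v₂))) * q0
        + r 0 ^ 2 * (sin (k * a) * cos (k * a)) * q1
    rw [this]; positivity
  obtain ⟨hev, hmem⟩ := floor_sub_add_floor_sub (even_floor_add_floor p0)
    (even_floor_add_floor p1) (even_floor_add_floor p2)
  have hμ : (v₁ + v₂) - (u₁ + u₂) = 2 * (k * (b + c)) / π := by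
    rw [hv₁, hv₂]; ring
  rw [hμ] at hmem
  have z0 := ncard_zeros_sin (p := 0) hk ha (by simpa using hs)
  have z1 := ncard_zeros_sin (p := u₁) hk (by positivity : 0 < 2 * b)
    (by rw [hv₁']; exact (mul_ne_zero_iff.1 p1.ne').1)
  have z2 := ncard_zeros_sin (p := u₂) hk (by positivity : 0 < 2 * c)
    (by rw [hv₂']; exact (mul_ne_zero_iff.1 p1.ne').2)
  -- On the Neumann lead `cos (k(x - a))` is a sine whose phase at the outer end is `π / 2`.
  have h3' : π * (1 / 2 - k * a / π) + k * a = π / 2 := by field_simp; ring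
  have z3 := ncard_zeros_sin (p := 1 / 2 - k * a / π) hk ha (by rw [h3']; simp)
  rw [show 1 / 2 - k * a / π + k * a / π = (1 / 2 : ℝ) by ring] at z3
  set f := ofCoeff a b c k (t • fun i => (r i : ℂ)) with hf
  have hval : ∀ (e : Fin 4) (x : ℝ), x ∈ Set.Ioo 0 ((![a, 2 * b, 2 * c, a] : Fin 4 → ℝ) e) →
      (f e x = 0 ↔ (![0, r 2, r 4, r 1] : Fin 4 → ℝ) e *
          cos (k * (x - (![0, b, c, a] : Fin 4 → ℝ) e)) +
        (![r 0, r 3, r 5, 0] : Fin 4 → ℝ) e *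
          sin (k * (x - (![0, b, c, a] : Fin 4 → ℝ) e)) = 0) := by
    intro e x hx
    have : f e x = t * (((![0, r 2, r 4, r 1] : Fin 4 → ℝ) e *
          cos (k * (x - (![0, b, c, a] : Fin 4 → ℝ) e)) +
        (![r 0, r 3, r 5, 0] : Fin 4 → ℝ) e *
          sin (k * (x - (![0, b, c, a] : Fin 4 → ℝ) e)) : ℝ) : ℂ) := by
      rw [hf, ofCoeff_apply ⟨hx.1.le, hx.2.le⟩, trig]
      fin_cases e <;> simp <;> ring
    rw [this, mul_eq_zero, or_iff_right ht, Complex.ofReal_eq_zero]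
  have w0 : {x | ((0 : Fin 4), x) ∈ (dihedralGraph a b c ha hb hc).zeros f} =
      {x | x ∈ Set.Ioo 0 a ∧ sin (π * 0 + k * x) = 0} := by
    ext x
    refine and_congr_right fun hx => (hval 0 x hx).trans ?_
    simp [hA]
  have w1 : {x | ((1 : Fin 4), x) ∈ (dihedralGraph a b c ha hb hc).zeros f} =
      {x | x ∈ Set.Ioo 0 (2 * b) ∧ sin (π * u₁ + k * x) = 0} := by
    ext x
    refine and_congr_right fun hx => (hval 1 x hx).trans ?_
    have := (e₁ x).1
    simp only [Matrix.cons_val] at this ⊢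
    rw [this, mul_eq_zero, or_iff_right hρ₁.ne']
  have w2 : {x | ((2 : Fin 4), x) ∈ (dihedralGraph a b c ha hb hc).zeros f} =
      {x | x ∈ Set.Ioo 0 (2 * c) ∧ sin (π * u₂ + k * x) = 0} := by
    ext x
    refine and_congr_right fun hx => (hval 2 x hx).trans ?_
    have := (e₂ x).1
    simp only [Matrix.cons_val] at this ⊢
    rw [this, mul_eq_zero, or_iff_right hρ₂.ne']
  have w3 : {x | ((3 : Fin 4), x) ∈ (dihedralGraph a b c ha hb hc).zeros f} =
      {x | x ∈ Set.Ioo 0 a ∧ sin (π * (1 / 2 - k * a / π) + k * x) = 0} := by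
    ext x
    refine and_congr_right fun hx => (hval 3 x hx).trans ?_
    have e : π * (1 / 2 - k * a / π) + k * x = k * (x - a) + π / 2 := by field_simp; ring
    rw [e, sin_add_pi_div_two]
    simp [hB]
  rw [← w0] at z0
  rw [← w1] at z1
  rw [← w2] at z2
  rw [← w3] at z3
  obtain ⟨hfin, hcard⟩ := ncard_eq_sum_fibers ((dihedralGraph a b c ha hb hc).zeros f)
    fun e => by
      fin_cases e
      · exact z0.1
      · exact z1.1
      · exact z2.1
      · exact z3.1
  refine ⟨hfin, _, hev, hmem, ?_⟩
  have hζ : sin (π * (2 * (k * a) / π)) ≠ 0 := by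
    rw [mul_div_cancel₀ _ hpi.ne', sin_two_mul]
    simp [hs, hcz]
  have hfl := floor_half_sub_floor (floor_lt_of_sin_ne_zero hζ)
  rw [show 2 * (k * a) / π / 2 = k * a / π by ring] at hfl
  rw [hcard, Fin.sum_univ_four]
  push_cast
  rw [z0.2, z1.2, z2.2, z3.2, ← hfl]
  norm_num
  ring

end Nodal

/-! ### The integer parts of the phase, and the theorem -/

section Main

variable {a b c k : ℝ}

theorem floor_phase_terms (ha : 0 < a) (hb : 0 < b) (hc : 0 < c) (hk : 0 < k) {n : ℕ}
    (h : ¬ IsCycleFrequency b c k) (hphase : phase a b c k = π * n)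
    (hs : sin (2 * (k * a)) ≠ 0) :
    ⌊(b + c) / (a + b + c) * (n : ℝ)⌋ = ⌊2 * (k * (b + c)) / π⌋ ∧
    ⌊2 * (k * a) / π⌋ = n - ⌊2 * (k * (b + c)) / π⌋ - 1 := by
  have hpi := pi_pos
  obtain ⟨ρ, hρ, h1, -⟩ := exists_mul_sin_phase h
  set ω := arctan (phaseIm b c k / phaseRe b c k) with hω
  have hn : (n : ℝ) = 2 * (k * a) / π + 2 * (k * (b + c)) / π + ω / π := by
    rw [phase, ← hω] at hphase
    field_simp
    linarith
  -- This angle and `2ka` add up to `πn`.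
  have hξ : sin (2 * (k * (b + c)) + ω) ≠ 0 := fun h0 => by
    obtain ⟨m, hm⟩ := sin_eq_zero_iff.1 h0
    refine hs (sin_eq_zero_iff.2 ⟨n - m, ?_⟩)
    rw [phase, ← hω] at hphase
    push_cast
    linear_combination -hphase - hm
  have e1 : π * (2 * (k * (b + c)) / π + ω / π) = 2 * (k * (b + c)) + ω := by field_simp
  have e2 : π * (2 * (k * (b + c)) / π) = 2 * (k * (b + c)) := by field_simp
  have hpos : 0 < sin (π * (2 * (k * (b + c)) / π + ω / π)) *
      sin (π * (2 * (k * (b + c)) / π)) := by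
    rw [e1, e2, sin_two_mul]
    have : sin (2 * (k * (b + c)) + ω) * (2 * sin (k * (b + c)) * cos (k * (b + c)))
        = 2 * ρ * sin (2 * (k * (b + c)) + ω) ^ 2 := by
      linear_combination -2 * sin (2 * (k * (b + c)) + ω) * h1
    rw [this]
    positivity
  have hfl : ⌊2 * (k * (b + c)) / π + ω / π⌋ = ⌊2 * (k * (b + c)) / π⌋ := by
    refine floor_eq_of_close hpos ?_
    rw [add_sub_cancel_left, abs_div, abs_of_pos hpi, div_lt_one hpi, abs_lt]
    exact ⟨by linarith [neg_pi_div_two_lt_arctan (phaseIm b c k / phaseRe b c k)],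
      by linarith [arctan_lt_pi_div_two (phaseIm b c k / phaseRe b c k)]⟩
  constructor
  · rw [← floor_mul_ratio (by positivity) (by positivity) hn hfl]
    congr 2
    field_simp
    ring
  · have h2 := floor_lt_of_sin_ne_zero (mul_ne_zero_iff.1 hpos.ne').1
    have h3 := Int.lt_floor_add_one (2 * (k * (b + c)) / π + ω / π)
    rw [hfl] at h2 h3
    rw [Int.floor_eq_iff]
    push_cast
    constructor <;> linarith

theorem exists_real_ofParts (a b c k u w : ℝ) :
    ∃ r : Fin 6 → ℝ, ofParts a b c k u w = fun i => (r i : ℂ) := by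
  refine ⟨fun i => (ofParts a b c k u w i).re, ?_⟩
  ext i
  refine (Complex.conj_eq_iff_re.1 ?_).symm
  fin_cases i <;> simp [ofParts, -Complex.ofReal_cos, -Complex.ofReal_sin]

end Main

theorem mainTheorem1 (a b c : ℝ) (ha : 0 < a) (hb : 0 < b) (hc : 0 < c)
    (n : ℕ) (lam : ℝ) (f : Fin 4 → ℝ → ℂ)
    (hn : (dihedralGraph a b c ha hb hc).IsNthEigenvalue n lam)
    (hsimple : (dihedralGraph a b c ha hb hc).IsSimpleEigenvalue lam)
    (hf : (dihedralGraph a b c ha hb hc).IsEigenfunction lam f)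
    (hvert : (dihedralGraph a b c ha hb hc).NonvanishingAtVertices f) :
    ((dihedralGraph a b c ha hb hc).zeros f).Finite ∧
    (((dihedralGraph a b c ha hb hc).zeros f).ncard : ℤ) =
      (n : ℤ) - (⌊(b + c) / (a + b + c) * (n : ℝ)⌋ + 1) % 2 := by
  unfold QuantumGraph.IsSimpleEigenvalue at hsimple
  have hlam : 0 < lam := by
    by_contra h0
    rw [dihedralGraph_multiplicity_of_nonpos ha hb hc (not_lt.1 h0)] at hsimple
    exact zero_ne_one hsimple
  obtain ⟨k, hk, rfl⟩ : ∃ k : ℝ, 0 < k ∧ lam = k ^ 2 :=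
    ⟨√lam, sqrt_pos.2 hlam, (sq_sqrt hlam.le).symm⟩
  obtain ⟨v, hv, rfl⟩ := (mem_eigenspace_iff ha hb hc hk).1 hf.1
  have hF₁ : v 0 * (sin (k * a) : ℝ) ≠ 0 := by
    have h1 := hvert.2 0 (by simp [dihedralGraph])
    have h2 : ofCoeff a b c k v 0 a = v 0 * (sin (k * a) : ℝ) := by
      rw [ofCoeff_apply ⟨ha.le, le_rfl⟩]
      simp [trig_center_zero]
    exact h2 ▸ h1
  have hF₂ : v 1 * (cos (k * a) : ℝ) ≠ 0 := by
    have h1 := hvert.1 3 (by simp [dihedralGraph])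
    have h2 : ofCoeff a b c k v 3 0 = v 1 * (cos (k * a) : ℝ) := by
      rw [ofCoeff_apply (a := a) (b := b) (c := c) (e := 3) ⟨le_rfl, ha.le⟩]
      simp [trig_zero]
    exact h2 ▸ h1
  -- A simple eigenvalue at a cycle frequency has its eigenfunction supported on the cycle, so it
  -- vanishes at `v₁`.
  have hcyc : ¬ IsCycleFrequency b c k := fun h => by
    rw [dihedralGraph_multiplicity_of_isCycleFrequency ha hb hc hk h] at hsimple
    have hcos : cos (2 * (k * a)) ≠ 0 := fun h0 => by
      rw [if_pos h0] at hsimple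
      exact absurd hsimple (by norm_num)
    have := ((isCoeff_iff_of_isCycleFrequency h v).1 hv).1
    exact (mul_ne_zero (mul_ne_zero_iff.1 hF₁).1 (Complex.ofReal_ne_zero.2 hcos)) this
  have hsec : secular a b c k = 0 := by
    by_contra h0
    rw [dihedralGraph_multiplicity_eq_zero ha hb hc hk hcyc h0] at hsimple
    exact zero_ne_one hsimple
  have hphase := phase_eq_of_isNthEigenvalue ha hb hc hk hn hcyc hsec
  have hs0 : sin (k * a) ≠ 0 := Complex.ofReal_ne_zero.1 (mul_ne_zero_iff.1 hF₁).2
  have hc0 : cos (k * a) ≠ 0 := Complex.ofReal_ne_zero.1 (mul_ne_zero_iff.1 hF₂).2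
  have hs : sin (2 * (k * a)) ≠ 0 := by
    rw [sin_two_mul]
    exact mul_ne_zero (mul_ne_zero two_ne_zero hs0) hc0
  obtain ⟨hfl₁, hfl₂⟩ := floor_phase_terms ha hb hc hk hcyc hphase hs
  obtain ⟨u, w, -, huw⟩ := isCoeff_iff_of_secular_eq_zero hcyc hsec
  obtain ⟨r, hr⟩ := exists_real_ofParts a b c k u w
  rw [hr] at huw
  obtain ⟨t, rfl⟩ := (huw v).1 hv
  have hA : t ≠ 0 ∧ r 0 ≠ 0 := by simpa using (mul_ne_zero_iff.1 hF₁).1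
  have hB : r 1 ≠ 0 := by
    have : t ≠ 0 ∧ r 1 ≠ 0 := by simpa using (mul_ne_zero_iff.1 hF₂).1
    exact this.2
  obtain ⟨hfin, Z, hZ, hmem, hcard⟩ := ncard_zeros_ofCoeff ha hb hc hk r
    ((huw _).2 ⟨1, one_smul _ _⟩) (mul_ne_zero hA.2 hs0) (mul_ne_zero hB hc0) hA.1
  refine ⟨hfin, ?_⟩
  rw [hcard, hfl₁, hfl₂]
  obtain ⟨hm0, hm1⟩ := hmem
  rw [Int.even_iff] at hZ
  -- `Z` is the even one of `⌊μ⌋` and `⌊μ⌋ + 1`, and the count is `n - ⌊μ⌋ - 1 + Z`.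
  omega
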